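/- Let $J=[n]\sqcup[n]^*$ with the fixed-point-free involution $a\mapsto a^*$. For $A\subseteq J$ let $A^*=\{a^*: a\in A\}$, and call $A$ admissible if $A\cap A^*=\emptyset$. An admissible matroid is a loopless matroid $\mathcal M$ on $J$ such that for every $A\subseteq J$ the rank $r(A)$ is the maximum, over all admissible independent sets $I\subseteq A$, of the number which is $|I|+2$ if there is a pair $\{a,a^*\}\subseteq A$ for which $I\cup\{a\}$ and $I\cup\{a^*\}$ are both independent with admissible closure, and which is $|I|$ otherwise. A ranked symplectic matroid $\mathcal S$ is the (nonempty) family of admissible bases of an admissible matroid $\mathcal M$, called an enveloping matroid of $\mathcal S$; its rank is the common size of its members. Let $L(\mathcal S)$ consist of the admissible flats of $\mathcal M$ and $J$. For $F\subseteq J$ put $e_F^\pm=\sum_{i\in F\cap[n]}e_i-\sum_{i^*\in F\cap[n]^*}e_i\in\mathbb R^n$. The Bergman fan $B(\mathcal S)$ consists of the cones $\{\sum_{j} a_j e^\pm_{F_j}: a_j\ge 0\}$ for all (possibly empty) chains $F_1\subsetneq\dots\subsetneq F_k$ in $L(\mathcal S)\setminus\{\emptyset,J\}$. For a cone $\sigma$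 let $N_\sigma$ be the set of points of $\mathbb Z^n$ in the linear span of $\sigma$. A Minkowski weight of dimension $d$ on $B(\mathcal S)$ is an integer-valued function $c$ on the $d$-dimensional cones such that for every $(d-1)$-dimensional cone $\tau$ the sum $\sum_{\sigma\supset\tau}c(\sigma)e_{\sigma/\tau}$ over the $d$-dimensional cones containing $\tau$ lies in the linear span of $\tau$, where $e_{\sigma/\tau}\in\sigma$ represents a generator of $N_\sigma/N_\tau$; $MW_d(B(\mathcal S))$ is the group of these weights. **Theorem 5.12.** Let $\mathcal S$ be a ranked symplectic matroid of rank $d+1$ with enveloping matroid $\mathcal M$, and let $\sigma,\sigma'$ be maximal (that is, $d$-dimensional) cones of $B(\mathcal S)$. Then $c(\sigma)=c(\sigma')$ for all $c\in MW_d(B(\mathcal S))$ if and only if there is a sequence $\sigma=\sigma_1,\dots,\sigma_k=\sigma'$ ($k\ge1$) of $d$-dimensional cones of $B(\mathcal S)$ such that for each $i\in[k-1]$ $$\operatorname{rank}_{\mathcal M}\bigl((F_i\cup F_i^*)\cap(F_{i+1}\cup F_{i+1}^*)\bigr)=d+1,$$ where $F_i$ is the largest flat in the chain of flats corresponding to $\sigma_i$.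 Moreover, $MW_d(B(\mathcal S))$ consists exactly of the integer-valued functions $c$ on the $d$-dimensional cones with $c(\sigma)=c(\sigma')$ whenever $\sigma$ and $\sigma'$ are joined by such a sequence. -/

import Mathlib

namespace RankedSymplectic

/-- The ground set `J = [n] ⊔ [n]*`: `Sum.inl i` is the element `i` and `Sum.inr i` is `i*`. -/
abbrev J (n : ℕ) : Type := Fin n ⊕ Fin n

/-- The involution `a ↦ a*` on `J`. -/
def star {n : ℕ} (a : J n) : J n := Sum.swap a

/-- The set `A* = {a* | a ∈ A}`. -/
def starSet {n : ℕ} (A : Set (J n)) : Set (J n) := star '' A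

/-- `A` is admissible if `A ∩ A* = ∅`. -/
def IsAdmissible {n : ℕ} (A : Set (J n)) : Prop := A ∩ starSet A = ∅

/-- `I^ad(M)`: the independent sets of `M` whose closure is admissible. -/
def indepAd {n : ℕ} (M : Matroid (J n)) : Set (Set (J n)) :=
  {I | M.Indep I ∧ IsAdmissible (M.closure I)}

open Classical in
/-- The number that an admissible independent set `I ⊆ A` contributes to the rank of `A`: it is
`|I| + 2` if some pair `{a, a*} ⊆ A` has `I ∪ {a}, I ∪ {a*} ∈ I^ad(M)`, and `|I|` otherwise. -/
noncomputable def rankCandidate {n : ℕ} (M : Matroid (J n)) (A I : Set (J n)) : ℕ∞ :=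
  if ∃ a, a ∈ A ∧ star a ∈ A ∧ I ∪ {a} ∈ indepAd M ∧ I ∪ {star a} ∈ indepAd M then
    I.encard + 2
  else I.encard

/-- An admissible matroid: a loopless matroid on `J` whose rank function is derived from its
admissible independent sets. -/
structure IsAdmissibleMatroid {n : ℕ} (M : Matroid (J n)) : Prop where
  ground_eq : M.E = Set.univ
  loopless : M.Loopless
  rank_eq : ∀ A : Set (J n),
    IsGreatest {m | ∃ I, M.Indep I ∧ IsAdmissible I ∧ I ⊆ A ∧ m = rankCandidate M A I} (M.eRk A)

/-- `S` is the ranked symplectic matroid enveloped by the admissible matroid `M`: it is the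
(nonempty) family of the admissible bases of `M`. -/
structure IsEnvelopingMatroid {n : ℕ} (M : Matroid (J n)) (S : Set (Set (J n))) : Prop where
  admissible : IsAdmissibleMatroid M
  nonempty : S.Nonempty
  eq_bases : S = {B | M.IsBase B ∧ IsAdmissible B}

/-- The lattice of flats `L(S)`: the admissible flats of the enveloping matroid `M`, and `J`. -/
def latticeOfFlats {n : ℕ} (M : Matroid (J n)) : Set (Set (J n)) :=
  {F | M.IsFlat F ∧ IsAdmissible F} ∪ {Set.univ}

/-- A (possibly empty) flag `F₁ ⊊ ⋯ ⊊ F_k` in `L(S) \ {∅, J}`, as a set of flats. -/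
def IsFlag {n : ℕ} (M : Matroid (J n)) (𝓕 : Set (Set (J n))) : Prop :=
  𝓕 ⊆ latticeOfFlats M \ {∅, Set.univ} ∧ IsChain (· ⊆ ·) 𝓕

/-- The signed unit vector of `a ∈ J`: `e_i` for `i ∈ [n]`, and `-e_i` for `i* ∈ [n]*`. -/
def signedUnit {n : ℕ} : J n → (Fin n → ℝ)
  | Sum.inl i => Pi.single i 1
  | Sum.inr i => -Pi.single i 1

open Classical in
/-- The vector `e_A^± = ∑_{a ∈ A} e_a^±` in `ℝⁿ`. -/
noncomputable def signedVec {n : ℕ} (A : Set (J n)) : Fin n → ℝ :=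
  ∑ a : J n, if a ∈ A then signedUnit a else 0

/-- The cone of nonnegative combinations of the vectors `e_F^±`, `F ∈ 𝓕`. -/
def flagCone {n : ℕ} (𝓕 : Set (Set (J n))) : PointedCone ℝ (Fin n → ℝ) :=
  PointedCone.hull ℝ (signedVec '' 𝓕)

/-- The Bergman fan `B(S)`, as a set of cones in `ℝⁿ`. -/
def bergmanFan {n : ℕ} (M : Matroid (J n)) : Set (PointedCone ℝ (Fin n → ℝ)) :=
  flagCone '' {𝓕 | IsFlag M 𝓕}

/-- The Bergman fan has finitely many cones (so the sums over its cones below are finite). -/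
theorem bergmanFan_finite {n : ℕ} (M : Matroid (J n)) : (bergmanFan M).Finite :=
  (Set.toFinite _).image _

/-- The linear span of a cone. -/
def linSpan {n : ℕ} (σ : PointedCone ℝ (Fin n → ℝ)) : Submodule ℝ (Fin n → ℝ) :=
  Submodule.span ℝ (σ : Set (Fin n → ℝ))

/-- The dimension of a cone. -/
noncomputable def coneDim {n : ℕ} (σ : PointedCone ℝ (Fin n → ℝ)) : ℕ :=
  Module.finrank ℝ (linSpan σ)

/-- `Σ_k`: the `k`-dimensional cones of the fan `Σ`. -/
def conesOfDim {n : ℕ} (fan : Set (PointedCone ℝ (Fin n → ℝ))) (k : ℕ) :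
    Set (PointedCone ℝ (Fin n → ℝ)) :=
  {σ ∈ fan | coneDim σ = k}

/-- The lattice `N_σ`: the points of `ℤⁿ` in the linear span of `σ`. -/
def coneLattice {n : ℕ} (σ : PointedCone ℝ (Fin n → ℝ)) : AddSubgroup (Fin n → ℝ) where
  carrier := {x | x ∈ linSpan σ ∧ ∀ i, ∃ m : ℤ, x i = m}
  zero_mem' := ⟨zero_mem _, fun _ => ⟨0, by simp⟩⟩
  add_mem' := by
    rintro x y ⟨hx, hx'⟩ ⟨hy, hy'⟩
    refine ⟨add_mem hx hy, fun i => ?_⟩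
    obtain ⟨a, ha⟩ := hx' i
    obtain ⟨b, hb⟩ := hy' i
    exact ⟨a + b, by simp [ha, hb]⟩
  neg_mem' := by
    rintro x ⟨hx, hx'⟩
    refine ⟨neg_mem hx, fun i => ?_⟩
    obtain ⟨a, ha⟩ := hx' i
    exact ⟨-a, by simp [ha]⟩

/-- `v` is a representative in `σ` of a generator of the lattice `N_σ / N_τ`. -/
def IsNormalVector {n : ℕ} (σ τ : PointedCone ℝ (Fin n → ℝ)) (v : Fin n → ℝ) : Prop :=
  v ∈ σ ∧ coneLattice σ = coneLattice τ ⊔ AddSubgroup.zmultiples v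

/-- A weight `c : Σ_k → ℤ` is a Minkowski weight if for every `(k-1)`-dimensional cone `τ` of the
fan the sum of `c(σ) e_{σ/τ}` over the `k`-dimensional cones `σ ⊇ τ` lies in the span of `τ`.
Two representatives `e_{σ/τ}` in `σ` differ by an element of `N_τ`, so the
condition does not depend on how they are chosen. -/
def IsMinkowskiWeight {n : ℕ} (fan : Set (PointedCone ℝ (Fin n → ℝ))) (k : ℕ)
    (c : conesOfDim fan k → ℤ) : Prop :=
  ∀ τ ∈ fan, coneDim τ + 1 = k →
    ∃ e : {σ : conesOfDim fan k // τ ≤ σ.1} → (Fin n → ℝ),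
      (∀ σ, IsNormalVector σ.1.1 τ (e σ)) ∧
      ∑ᶠ σ : {σ : conesOfDim fan k // τ ≤ σ.1}, c σ.1 • e σ ∈ linSpan τ

/-- `F` is the largest flat of a flag whose cone is `σ`. -/
def IsTopFlat {n : ℕ} (M : Matroid (J n)) (σ : PointedCone ℝ (Fin n → ℝ)) (F : Set (J n)) :
    Prop :=
  ∃ 𝓕, IsFlag M 𝓕 ∧ flagCone 𝓕 = σ ∧ IsGreatest 𝓕 F

/-- One step of a chain of `d`-dimensional cones: the top flats `F`, `F'` of the two cones satisfy
`rank_M ((F ∪ F*) ∩ (F' ∪ F'*)) = d + 1`. -/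
def Linked {n : ℕ} (M : Matroid (J n)) (d : ℕ) (σ σ' : conesOfDim (bergmanFan M) d) : Prop :=
  ∃ F F', IsTopFlat M σ.1 F ∧ IsTopFlat M σ'.1 F' ∧
    M.eRk ((F ∪ starSet F) ∩ (F' ∪ starSet F')) = (d : ℕ∞) + 1

end RankedSymplectic

namespace RankedSymplectic

open Set

variable {n : ℕ} {M : Matroid (J n)}

@[simp] lemma star_star (a : J n) : star (star a) = a := Sum.swap_swap a

lemma star_ne (a : J n) : star a ≠ a := by
  rcases a with a | a <;> simp [star]

@[simp] lemma mem_starSet {A : Set (J n)} {a : J n} : a ∈ starSet A ↔ star a ∈ A :=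
  ⟨by rintro ⟨b, hb, rfl⟩; simpa using hb, fun h => ⟨star a, h, star_star a⟩⟩

lemma isAdmissible_iff {A : Set (J n)} : IsAdmissible A ↔ ∀ a ∈ A, star a ∉ A := by
  simp [IsAdmissible, Set.eq_empty_iff_forall_notMem]

lemma IsAdmissible.star_notMem {A : Set (J n)} (h : IsAdmissible A) {a : J n} (ha : a ∈ A) :
    star a ∉ A := isAdmissible_iff.1 h a ha

lemma IsAdmissible.notMem_of_star {A : Set (J n)} (h : IsAdmissible A) {a : J n}
    (ha : star a ∈ A) : a ∉ A := fun h' => h.star_notMem h' ha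

lemma IsAdmissible.subset {A B : Set (J n)} (h : IsAdmissible B) (hAB : A ⊆ B) :
    IsAdmissible A :=
  isAdmissible_iff.2 fun _ ha h' => h.star_notMem (hAB ha) (hAB h')

/-! ### Ranks and closures -/

/-- The rank function with values in `ℕ`. -/
noncomputable def rk (M : Matroid (J n)) (X : Set (J n)) : ℕ := (M.eRk X).toNat

@[simp] lemma coe_rk (X : Set (J n)) : (rk M X : ℕ∞) = M.eRk X := by
  apply ENat.natCast_toNat
  exact ((M.eRk_le_encard X).trans_lt (Set.toFinite X).encard_lt_top).ne

lemma rk_mono {X Y : Set (J n)} (h : X ⊆ Y) : rk M X ≤ rk M Y := by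
  have := M.eRk_mono h
  rw [← coe_rk, ← coe_rk] at this
  exact_mod_cast this

@[simp] lemma rk_empty : rk M ∅ = 0 := by simp [rk]

@[simp] lemma rk_closure (X : Set (J n)) : rk M (M.closure X) = rk M X := by simp [rk]

lemma rk_insert_of_notMem (hE : M.E = univ) {X : Set (J n)} {a : J n} (ha : a ∉ M.closure X) :
    rk M (insert a X) = rk M X + 1 := by
  have := M.eRk_insert_eq_add_one (X := X) (e := a) ⟨by rw [hE]; trivial, ha⟩
  rw [← coe_rk, ← coe_rk] at this
  exact_mod_cast this

lemma rk_insert_of_mem {X : Set (J n)} {a : J n} (ha : a ∈ M.closure X) :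
    rk M (insert a X) = rk M X := by
  rw [← rk_closure, Matroid.closure_insert_eq_of_mem_closure ha, rk_closure]

lemma subset_closure_self (hE : M.E = univ) (X : Set (J n)) : X ⊆ M.closure X :=
  M.subset_closure X (by rw [hE]; exact subset_univ X)

lemma closure_subset_of_isFlat {X F : Set (J n)} (hF : M.IsFlat F) (h : X ⊆ F) :
    M.closure X ⊆ F := hF.closure ▸ M.closure_subset_closure h

lemma eq_of_isFlat_of_rk_le (hE : M.E = univ) {X Y : Set (J n)} (hX : M.IsFlat X)
    (h : X ⊆ Y) (hr : rk M Y ≤ rk M X) : X = Y := by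
  refine h.antisymm fun a ha => ?_
  by_contra haX
  have h1 := rk_insert_of_notMem hE (X := X) (a := a) (by rwa [hX.closure])
  have h2 : rk M (insert a X) ≤ rk M Y := rk_mono (insert_subset ha h)
  omega

lemma rk_lt_of_ssubset (hE : M.E = univ) {X Y : Set (J n)} (hX : M.IsFlat X) (h : X ⊂ Y) :
    rk M X < rk M Y := by
  by_contra hr
  exact h.ne (eq_of_isFlat_of_rk_le hE hX h.subset (not_lt.1 hr))

lemma closure_insert_eq_of_rk (hE : M.E = univ) {X F : Set (J n)} {a : J n} (hF : M.IsFlat F)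
    (hX : X ⊆ F) (ha : a ∈ F) (haX : a ∉ M.closure X) (hr : rk M F ≤ rk M X + 1) :
    M.closure (insert a X) = F :=
  eq_of_isFlat_of_rk_le hE (M.isFlat_closure _)
    (closure_subset_of_isFlat hF (insert_subset ha hX))
    (by rw [rk_closure, rk_insert_of_notMem hE haX]; exact hr)

lemma IsAdmissibleMatroid.closure_empty (hM : IsAdmissibleMatroid M) : M.closure ∅ = ∅ := by
  have := hM.loopless
  rw [Matroid.closure_empty, Matroid.loops_eq_empty]

/-! ### Admissibility of flats -/

/-- A flat that is not admissible is stable under the involution. -/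
theorem IsAdmissibleMatroid.star_mem (hM : IsAdmissibleMatroid M) {F : Set (J n)}
    (hF : M.IsFlat F) (hadm : ¬ IsAdmissible F) {p : J n} (hp : p ∈ F) : star p ∈ F := by
  have hE := hM.ground_eq
  have := hM.loopless
  by_contra hp'
  have hpi : M.Indep {p} := by
    rw [Matroid.indep_singleton]
    exact Matroid.isNonloop_of_loopless (by rw [hE]; trivial)
  obtain ⟨K, hK, hpK⟩ := hpi.subset_isBasis_of_subset (singleton_subset_iff.2 hp)
  rw [singleton_subset_iff] at hpK
  have hKF : M.closure K = F := by rw [hK.closure_eq_closure, hF.closure]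
  have hsK : star p ∉ K := fun h => hp' (hK.subset h)
  have hA : M.Indep (insert (star p) K) := by
    rw [hK.indep.insert_indep_iff_of_notMem hsK]
    exact ⟨by rw [hE]; trivial, by rwa [hKF]⟩
  -- The rank formula is tested on the independent set K ∪ {p*}, of size |K| + 1.
  obtain ⟨I, hI, hIad, hIA, hc⟩ := (hM.rank_eq (insert (star p) K)).1
  rw [hA.eRk_eq_encard] at hc
  have hfin : (insert (star p) K).Finite := Set.toFinite _
  unfold rankCandidate at hc
  split_ifs at hc with h
  · obtain ⟨q, hq, hq', h1, h2⟩ := h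
    have hqI : q ∉ I := fun h => by
      have := h2.2.subset (subset_closure_self hE _)
      exact this.star_notMem (a := q) (Or.inl h) (Or.inr rfl)
    have hqI' : star q ∉ I := fun h => by
      have := h1.2.subset (subset_closure_self hE _)
      exact this.star_notMem (a := q) (Or.inr rfl) (Or.inl h)
    have hIeq : insert q (insert (star q) I) = insert (star p) K := by
      refine (hfin.subset (insert_subset hq (insert_subset hq' hIA))).eq_of_subset_of_encard_le
        (insert_subset hq (insert_subset hq' hIA)) ?_
      rw [hc, encard_insert_of_notMem, encard_insert_of_notMem hqI', add_assoc]
      · norm_num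
      · rintro (h | h)
        · exact star_ne q h.symm
        · exact hqI h
    -- If I ∪ {r} contains K, its admissible closure contains F = cl K.
    have key : ∀ r, I ∪ {r} ∈ indepAd M → (∀ x ∈ K, x = r ∨ x ∈ I) → False := by
      intro r hr hx
      refine hadm (hKF ▸ hr.2.subset (M.closure_subset_closure fun x hxK => ?_))
      rcases hx x hxK with rfl | h
      · exact Or.inr rfl
      · exact Or.inl h
    have hpm : p ∈ insert q (insert (star q) I) := hIeq ▸ Or.inr hpK
    have hspm : star p ∈ insert q (insert (star q) I) := hIeq ▸ Or.inl rfl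
    have hKm : ∀ x ∈ K, x ∈ insert q (insert (star q) I) := fun x hx => hIeq ▸ Or.inr hx
    -- K ∪ {p*} is I together with q, q*. If {q, q*} = {p, p*}, then K ⊆ I ∪ {p}, against `key`;
    -- otherwise p and p* both lie in the admissible set I.
    by_cases hqp : q = p
    · subst hqp
      refine key q h1 fun x hx => ?_
      rcases hKm x hx with h | rfl | h
      · exact Or.inl h
      · exact (hsK hx).elim
      · exact Or.inr h
    by_cases hqp' : q = star p
    · subst hqp'
      rw [star_star] at *
      refine key p h2 fun x hx => ?_
      rcases hKm x hx with rfl | h | h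
      · exact (hsK hx).elim
      · exact Or.inl h
      · exact Or.inr h
    have hpI : p ∈ I := by
      rcases hpm with h | h | h
      · exact (hqp h.symm).elim
      · exact (hqp' (by rw [h, star_star])).elim
      · exact h
    have hpI' : star p ∈ I := by
      rcases hspm with h | h | h
      · exact (hqp' h.symm).elim
      · exact (hqp (by rw [← star_star q, ← h, star_star])).elim
      · exact h
    exact hIad.star_notMem hpI hpI'
  · have : I = insert (star p) K :=
      (hfin.subset hIA).eq_of_subset_of_encard_le hIA hc.le
    exact hIad.star_notMem (a := p) (this ▸ Or.inr hpK) (this ▸ Or.inl rfl)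

/-- Adjoining `a*` instead of `a` to an admissible flat preserves admissibility. -/
theorem IsAdmissibleMatroid.admissible_closure_insert_star (hM : IsAdmissibleMatroid M)
    {X : Set (J n)} {a : J n} (h : IsAdmissible (M.closure (insert a X)))
    (ha : a ∉ M.closure X) (ha' : star a ∉ M.closure X) :
    IsAdmissible (M.closure (insert (star a) X)) := by
  have hE := hM.ground_eq
  by_contra hn
  have hs := subset_closure_self hE (insert (star a) X)
  have h1 : a ∈ M.closure (insert (star a) X) := by
    simpa using hM.star_mem (M.isFlat_closure _) hn (hs (Or.inl rfl))
  refine hn ?_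
  rwa [← closure_insert_eq_of_rk hE (M.isFlat_closure (insert (star a) X))
    ((subset_insert _ _).trans hs) h1 ha]
  rw [rk_closure, rk_insert_of_notMem hE ha']

/-- Positive rank makes J nonempty, so J contains a pair a, a* and is not admissible; an admissible
flat is thus proper. -/
lemma rk_lt_of_admissible (hE : M.E = univ) {d : ℕ} (hr : rk M univ = d + 1) {F : Set (J n)}
    (hF : M.IsFlat F) (hadm : IsAdmissible F) : rk M F ≤ d := by
  have hne : F ≠ univ := by
    rintro rfl
    have : IsEmpty (J n) := ⟨fun a => hadm.star_notMem (mem_univ a) (mem_univ _)⟩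
    have h0 : (univ : Set (J n)) = ∅ := Set.eq_empty_of_isEmpty _
    rw [h0, rk_empty] at hr
    omega
  have := rk_lt_of_ssubset hE hF (ssubset_univ_iff.2 hne)
  omega

/-! ### Independent lists -/

/-- The closure of the set of entries of a list. -/
abbrev cl (M : Matroid (J n)) (l : List (J n)) : Set (J n) := M.closure {x | x ∈ l}

/-- The entries of the list are distinct and form an independent set. -/
def IndepList (M : Matroid (J n)) (l : List (J n)) : Prop := rk M {x | x ∈ l} = l.length

lemma setOf_mem_cons (a : J n) (l : List (J n)) : {x | x ∈ a :: l} = insert a {x | x ∈ l} := by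
  ext; simp

lemma setOf_mem_perm {l l' : List (J n)} (h : l.Perm l') : {x | x ∈ l} = {x | x ∈ l'} := by
  ext; simp [h.mem_iff]

lemma cl_perm {l l' : List (J n)} (h : l.Perm l') : cl M l = cl M l' := by
  rw [cl, setOf_mem_perm h]

lemma IndepList.perm {l l' : List (J n)} (h : IndepList M l) (hp : l.Perm l') :
    IndepList M l' := by
  rw [IndepList, ← setOf_mem_perm hp, ← hp.length_eq]; exact h

lemma mem_cl (hE : M.E = univ) {a : J n} {l : List (J n)} (h : a ∈ l) : a ∈ cl M l :=
  subset_closure_self hE _ h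

lemma cl_subset_cl_cons (a : J n) (l : List (J n)) : cl M l ⊆ cl M (a :: l) :=
  M.closure_subset_closure fun _ hx => List.mem_cons_of_mem _ hx

lemma rk_list_le (hE : M.E = univ) (l : List (J n)) : rk M {x | x ∈ l} ≤ l.length := by
  induction l with
  | nil => simp
  | cons a l ih =>
    rw [setOf_mem_cons, List.length_cons]
    by_cases h : a ∈ M.closure {x | x ∈ l}
    · rw [rk_insert_of_mem h]; omega
    · rw [rk_insert_of_notMem hE h]; omega

lemma indepList_cons (hE : M.E = univ) {a : J n} {l : List (J n)} :
    IndepList M (a :: l) ↔ a ∉ cl M l ∧ IndepList M l := by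
  unfold IndepList
  rw [setOf_mem_cons, List.length_cons]
  have := rk_list_le hE l
  by_cases h : a ∈ M.closure {x | x ∈ l}
  · rw [rk_insert_of_mem h]
    constructor
    · intro; omega
    · exact fun h' => (h'.1 h).elim
  · rw [rk_insert_of_notMem hE h]
    constructor
    · intro; exact ⟨h, by omega⟩
    · intro h'; omega

lemma IndepList.rk_cl {l : List (J n)} (h : IndepList M l) : rk M (cl M l) = l.length := by
  rw [cl, rk_closure]; exact h

/-- An independent list inside a set of large rank whose closure is admissible can be extended
within that set to a longer such list. -/
theorem IsAdmissibleMatroid.exists_extension (hM : IsAdmissibleMatroid M) {C : Set (J n)}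
    {l : List (J n)} (hl : IndepList M l) (hadm : IsAdmissible (cl M l))
    (hne : l ≠ []) (hlen : l.length + 1 < rk M C) :
    ∃ a ∈ C, IndepList M (a :: l) ∧ IsAdmissible (cl M (a :: l)) := by
  have hE := hM.ground_eq
  by_contra! hcon
  obtain ⟨x, hx⟩ := List.exists_mem_of_ne_nil l hne
  have hxs : star x ∉ cl M l := hadm.star_notMem (mem_cl hE hx)
  -- A non-admissible closure of a :: l contains x, hence x*, so it is the flat spanned by l and x*
  -- whatever a is. All of C then lies in this flat, of rank `l.length + 1`.
  have hsub : C ⊆ M.closure (insert (star x) {y | y ∈ l}) := by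
    intro a ha
    by_cases hal : a ∈ cl M l
    · exact M.closure_subset_closure (subset_insert _ _) hal
    · have hn := hcon a ha ((indepList_cons hE).2 ⟨hal, hl⟩)
      have hsx := hM.star_mem (M.isFlat_closure _) hn (mem_cl hE (List.mem_cons_of_mem a hx))
      rw [closure_insert_eq_of_rk (X := {y | y ∈ l}) hE (M.isFlat_closure _) (fun y hy =>
        mem_cl hE (List.mem_cons_of_mem a hy)) hsx hxs]
      · exact mem_cl hE (by simp)
      · rw [rk_closure, setOf_mem_cons, rk_insert_of_notMem hE hal]
  have := rk_mono (M := M) hsub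
  rw [rk_closure, rk_insert_of_notMem hE hxs, hl] at this
  omega

/-! ### Signed coordinates and the cones of chains -/

/-- The indicator function of a subset of `J`. -/
noncomputable def ind (A : Set (J n)) (a : J n) : ℝ := A.indicator (fun _ => 1) a

lemma ind_of_mem {A : Set (J n)} {a : J n} (h : a ∈ A) : ind A a = 1 := by simp [ind, h]

lemma ind_of_notMem {A : Set (J n)} {a : J n} (h : a ∉ A) : ind A a = 0 := by simp [ind, h]

lemma ind_nonneg (A : Set (J n)) (a : J n) : 0 ≤ ind A a :=
  Set.indicator_nonneg (fun _ _ => zero_le_one) a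

/-- The linear functional `x ↦ ± x i` attached to an element of `J`. -/
def coord : J n → (Fin n → ℝ) →ₗ[ℝ] ℝ
  | Sum.inl i => LinearMap.proj i
  | Sum.inr i => -LinearMap.proj i

lemma coord_signedUnit (a b : J n) :
    coord a (signedUnit b) = ind {b} a - ind {b} (star a) := by
  rcases a with i | i <;> rcases b with j | j <;> by_cases h : i = j <;>
    simp [coord, signedUnit, ind, star, Set.indicator, h]

lemma coord_signedVec (a : J n) (A : Set (J n)) :
    coord a (signedVec A) = ind A a - ind A (star a) := by
  classical
  have h : ∀ c : J n, ind A c = ∑ b : J n, if b ∈ A then ind {b} c else 0 := by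
    intro c
    rw [Finset.sum_eq_single c]
    · by_cases hc : c ∈ A <;> simp [ind, hc]
    · intro b _ hb
      simp [ind, hb.symm]
    · simp
  rw [h, h, ← Finset.sum_sub_distrib, signedVec, map_sum]
  refine Finset.sum_congr rfl fun b _ => ?_
  split_ifs
  · exact coord_signedUnit a b
  · simp

lemma coord_signedVec_of_mem {A : Set (J n)} (hA : IsAdmissible A) {a : J n} (ha : a ∈ A) :
    coord a (signedVec A) = 1 := by
  rw [coord_signedVec, ind_of_mem ha, ind_of_notMem (hA.star_notMem ha), sub_zero]

lemma coord_signedVec_of_notMem {A : Set (J n)} {a : J n} (ha : a ∉ A) (ha' : star a ∉ A) :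
    coord a (signedVec A) = 0 := by
  rw [coord_signedVec, ind_of_notMem ha, ind_of_notMem ha', sub_zero]

lemma eq_of_coord_eq {x y : Fin n → ℝ} (h : ∀ a, coord a x = coord a y) : x = y :=
  funext fun i => h (Sum.inl i)

lemma signedVec_empty : signedVec (∅ : Set (J n)) = 0 := by simp [signedVec]

/-- The points of the lattice `ℤⁿ` in `ℝⁿ`. -/
def IsIntegral (x : Fin n → ℝ) : Prop := ∀ i, ∃ m : ℤ, x i = m

lemma IsIntegral.coord {x : Fin n → ℝ} (h : IsIntegral x) (a : J n) :
    ∃ m : ℤ, RankedSymplectic.coord a x = m := by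
  rcases a with i | i
  · exact h i
  · obtain ⟨m, hm⟩ := h i
    exact ⟨-m, by simp [RankedSymplectic.coord, hm]⟩

lemma isIntegral_signedVec (A : Set (J n)) : IsIntegral (signedVec A) := by
  intro i
  change ∃ m : ℤ, coord (Sum.inl i) (signedVec A) = m
  rw [coord_signedVec]
  have : ∀ a, ∃ m : ℤ, ind A a = m := fun a => by
    by_cases h : a ∈ A
    · exact ⟨1, by simp [ind_of_mem h]⟩
    · exact ⟨0, by simp [ind_of_notMem h]⟩
  obtain ⟨p, hp⟩ := this (Sum.inl i)
  obtain ⟨q, hq⟩ := this (star (Sum.inl i))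
  exact ⟨p - q, by simp [hp, hq]⟩

lemma mem_coneLattice {σ : PointedCone ℝ (Fin n → ℝ)} {x : Fin n → ℝ} :
    x ∈ coneLattice σ ↔ x ∈ linSpan σ ∧ IsIntegral x := Iff.rfl

/-- A chain of nonempty admissible sets. -/
structure AdmChain (𝓕 : Set (Set (J n))) : Prop where
  nonempty : ∀ F ∈ 𝓕, F.Nonempty
  admissible : ∀ F ∈ 𝓕, IsAdmissible F
  chain : IsChain (· ⊆ ·) 𝓕

lemma exists_greatest_of_chain {𝓕 : Set (Set (J n))} (h : IsChain (· ⊆ ·) 𝓕)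
    (hne : 𝓕.Nonempty) : ∃ F, IsGreatest 𝓕 F := by
  obtain ⟨F, hF⟩ := (Set.toFinite 𝓕).exists_maximal hne
  exact ⟨F, hF.1, fun G hG => (h.total hF.1 hG).elim (fun h => hF.2 hG h) id⟩

lemma exists_least_of_chain {𝓕 : Set (Set (J n))} (h : IsChain (· ⊆ ·) 𝓕)
    (hne : 𝓕.Nonempty) : ∃ F, IsLeast 𝓕 F := by
  obtain ⟨F, hF⟩ := (Set.toFinite 𝓕).exists_minimal hne
  exact ⟨F, hF.1, fun G hG => (h.total hF.1 hG).elim id (fun h => hF.2 hG h)⟩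

/-- The functional reading off the coefficient of `signedVec F` on the span of a chain. -/
lemma AdmChain.exists_dual {𝓕 : Set (Set (J n))} (h : AdmChain 𝓕) {F : Set (J n)} (hF : F ∈ 𝓕) :
    ∃ δ : (Fin n → ℝ) →ₗ[ℝ] ℝ, δ (signedVec F) = 1 ∧
      (∀ G ∈ 𝓕, G ≠ F → δ (signedVec G) = 0) ∧ ∀ x, IsIntegral x → ∃ m : ℤ, δ x = m := by
  -- With a in F but in no smaller member, `coord a` is 1 on the members containing F and 0 on the
  -- others; if there is a next member H, subtracting `coord b` for b ∈ H \ F leaves F alone.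
  have hlow : ∃ a ∈ F, ∀ G ∈ 𝓕, G ⊂ F → a ∉ G := by
    by_cases hne : {G ∈ 𝓕 | G ⊂ F}.Nonempty
    · obtain ⟨G, hG, hmax⟩ := exists_greatest_of_chain (h.chain.mono (sep_subset _ _)) hne
      obtain ⟨a, ha, haG⟩ := exists_of_ssubset hG.2
      exact ⟨a, ha, fun G' hG' hlt ha' => haG (hmax ⟨hG', hlt⟩ ha')⟩
    · obtain ⟨a, ha⟩ := h.nonempty F hF
      exact ⟨a, ha, fun G hG hlt _ => hne ⟨G, hG, hlt⟩⟩
  obtain ⟨a, ha, hav⟩ := hlow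
  have hzero : ∀ G ∈ 𝓕, G ⊂ F → coord a (signedVec G) = 0 := fun G hG hlt =>
    coord_signedVec_of_notMem (hav G hG hlt)
      fun h' => (h.admissible F hF).star_notMem ha (hlt.subset h')
  by_cases hne : {G ∈ 𝓕 | F ⊂ G}.Nonempty
  · obtain ⟨H, hH, hmin⟩ := exists_least_of_chain (h.chain.mono (sep_subset _ _)) hne
    obtain ⟨b, hb, hbF⟩ := exists_of_ssubset hH.2
    have hbF' : ∀ G, G ⊆ F → coord b (signedVec G) = 0 := fun G hG =>
      coord_signedVec_of_notMem (fun h' => hbF (hG h'))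
        fun h' => (h.admissible H hH.1).star_notMem hb (hH.2.subset (hG h'))
    refine ⟨coord a - coord b, ?_, fun G hG hne' => ?_, fun x hx => ?_⟩
    · rw [LinearMap.sub_apply, coord_signedVec_of_mem (h.admissible F hF) ha, hbF' F subset_rfl,
        sub_zero]
    · rw [LinearMap.sub_apply]
      rcases h.chain.total hG hF with h' | h'
      · rw [hzero G hG (h'.ssubset_of_ne hne'), hbF' G h', sub_zero]
      · have hHG : H ⊆ G := hmin ⟨hG, h'.ssubset_of_ne hne'.symm⟩
        rw [coord_signedVec_of_mem (h.admissible G hG) (h' ha),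
          coord_signedVec_of_mem (h.admissible G hG) (hHG hb), sub_self]
    · obtain ⟨p, hp⟩ := hx.coord a
      obtain ⟨q, hq⟩ := hx.coord b
      exact ⟨p - q, by simp [hp, hq]⟩
  · refine ⟨coord a, coord_signedVec_of_mem (h.admissible F hF) ha, fun G hG hne' => ?_,
      fun x hx => hx.coord a⟩
    rcases h.chain.total hG hF with h' | h'
    · exact hzero G hG (h'.ssubset_of_ne hne')
    · exact (hne ⟨G, hG, h'.ssubset_of_ne hne'.symm⟩).elim

lemma AdmChain.linearIndependent {𝓕 : Set (Set (J n))} (h : AdmChain 𝓕) :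
    LinearIndependent ℝ (fun F : 𝓕 => signedVec F.1) := by
  rw [linearIndependent_iff']
  intro s g hg F hF
  obtain ⟨δ, h1, h0, -⟩ := h.exists_dual F.2
  have := congrArg δ hg
  rw [map_sum, map_zero, Finset.sum_eq_single F] at this
  · simpa [h1] using this
  · intro G _ hGF
    rw [map_smul, h0 G.1 G.2 (fun h => hGF (Subtype.ext h)), smul_zero]
  · exact fun h => (h hF).elim

lemma linSpan_flagCone (𝓕 : Set (Set (J n))) :
    linSpan (flagCone 𝓕) = Submodule.span ℝ (signedVec '' 𝓕) :=
  Submodule.span_span_of_tower _ _ _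

lemma AdmChain.coneDim_flagCone {𝓕 : Set (Set (J n))} (h : AdmChain 𝓕) :
    coneDim (flagCone 𝓕) = 𝓕.ncard := by
  classical
  have : Fintype 𝓕 := Fintype.ofFinite _
  rw [coneDim, linSpan_flagCone, Set.image_eq_range, finrank_span_eq_card h.linearIndependent,
    ← Nat.card_eq_fintype_card, Nat.card_coe_set_eq]

lemma signedVec_mem_flagCone {𝓕 : Set (Set (J n))} {F : Set (J n)} (hF : F ∈ 𝓕) :
    signedVec F ∈ flagCone 𝓕 :=
  Submodule.subset_span ⟨F, hF, rfl⟩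

/-- The vectors `signedVec F`, for `F` in a chain, are the only ones of this form in its cone. -/
lemma AdmChain.mem_of_signedVec_mem {𝓕 : Set (Set (J n))} (h : AdmChain 𝓕) {G : Set (J n)}
    (hG : G.Nonempty) (hadm : IsAdmissible G) (hmem : signedVec G ∈ flagCone 𝓕) : G ∈ 𝓕 := by
  classical
  have : Fintype 𝓕 := Fintype.ofFinite _
  rw [flagCone, PointedCone.hull, Set.image_eq_range, Submodule.mem_span_range_iff_exists_fun]
    at hmem
  obtain ⟨c, hc⟩ := hmem
  have hco : ∀ a, ind G a - ind G (star a) =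
      ∑ F : 𝓕, (c F : ℝ) * (ind F.1 a - ind F.1 (star a)) := by
    intro a
    rw [← coord_signedVec, ← hc, map_sum]
    refine Finset.sum_congr rfl fun F _ => ?_
    rw [← coord_signedVec]
    exact map_smul (coord a) (c F : ℝ) _
  -- In a chain of admissible sets no member contains a* once one contains a, so positive
  -- coefficients cannot cancel.
  have hpos : ∀ a, (∃ F : 𝓕, 0 < (c F : ℝ) ∧ a ∈ F.1) → a ∈ G := by
    rintro a ⟨F, hF, haF⟩
    have h1 : ∀ F' : 𝓕, star a ∉ F'.1 := by
      intro F' h'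
      rcases h.chain.total F.2 F'.2 with hs | hs
      · exact (h.admissible _ F'.2).star_notMem (hs haF) h'
      · exact (h.admissible _ F.2).star_notMem haF (hs h')
    have h2 : 0 < ∑ F : 𝓕, (c F : ℝ) * (ind F.1 a - ind F.1 (star a)) := by
      refine Finset.sum_pos' (fun F' _ => ?_) ⟨F, Finset.mem_univ _, ?_⟩
      · rw [ind_of_notMem (h1 F'), sub_zero]
        exact mul_nonneg (c F').2 (ind_nonneg _ _)
      · rw [ind_of_notMem (h1 F), ind_of_mem haF]
        simpa using hF
    by_contra ha
    rw [← hco, ind_of_notMem ha] at h2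
    linarith [ind_nonneg G (star a)]
  have hneg : ∀ a ∈ G, ∃ F : 𝓕, 0 < (c F : ℝ) ∧ a ∈ F.1 := by
    intro a ha
    by_contra! hcon
    have h2 : ∑ F : 𝓕, (c F : ℝ) * (ind F.1 a - ind F.1 (star a)) ≤ 0 := by
      refine Finset.sum_nonpos fun F _ => ?_
      rcases (c F).2.eq_or_lt with h0 | h0
      · rw [show (c F : ℝ) = 0 from h0.symm, zero_mul]
      · rw [ind_of_notMem (hcon F h0)]
        have := mul_nonneg (c F).2 (ind_nonneg F.1 (star a))
        simpa using this
    rw [← hco, ind_of_mem ha, ind_of_notMem (hadm.star_notMem ha)] at h2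
    norm_num at h2
  obtain ⟨a, ha⟩ := hG
  obtain ⟨F, hF, -⟩ := hneg a ha
  -- G is the union of the members with positive coefficient, which is the largest of them.
  obtain ⟨T, ⟨hT, hTpos⟩, hmax⟩ := exists_greatest_of_chain
    (𝓕 := {F | ∃ hF : F ∈ 𝓕, 0 < (c ⟨F, hF⟩ : ℝ)}) (h.chain.mono fun F hF => hF.1)
    ⟨F.1, F.2, hF⟩
  have : G = T := by
    ext b
    constructor
    · intro hb
      obtain ⟨F', h1, h2⟩ := hneg b hb
      exact hmax ⟨F'.2, h1⟩ h2
    · exact fun hb => hpos b ⟨⟨T, hT⟩, hTpos, hb⟩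
  rwa [this]

lemma AdmChain.flagCone_le_iff {𝓕 𝓖 : Set (Set (J n))} (h𝓕 : AdmChain 𝓕) (h𝓖 : AdmChain 𝓖) :
    flagCone 𝓕 ≤ flagCone 𝓖 ↔ 𝓕 ⊆ 𝓖 := by
  constructor
  · exact fun h F hF => h𝓖.mem_of_signedVec_mem (h𝓕.nonempty F hF) (h𝓕.admissible F hF)
      (h (signedVec_mem_flagCone hF))
  · exact fun h => Submodule.span_mono (image_mono h)

lemma AdmChain.flagCone_injective {𝓕 𝓖 : Set (Set (J n))} (h𝓕 : AdmChain 𝓕) (h𝓖 : AdmChain 𝓖)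
    (h : flagCone 𝓕 = flagCone 𝓖) : 𝓕 = 𝓖 :=
  ((h𝓕.flagCone_le_iff h𝓖).1 h.le).antisymm ((h𝓖.flagCone_le_iff h𝓕).1 h.ge)

/-! ### Normal vectors of a cone over a facet -/

section NormalVector

variable {𝓣 : Set (Set (J n))} {G : Set (J n)}

/-- Being integral, 1 at the vector of G and zero on the span of 𝓣, δ identifies the quotient
lattice N_σ/N_τ with ℤ. -/
lemma exists_dual_insert (h : AdmChain (insert G 𝓣)) (hG : G ∉ 𝓣) :
    ∃ δ : (Fin n → ℝ) →ₗ[ℝ] ℝ, δ (signedVec G) = 1 ∧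
      (∀ x ∈ Submodule.span ℝ (signedVec '' 𝓣), δ x = 0) ∧
      (∀ x, IsIntegral x → ∃ m : ℤ, δ x = m) ∧
      ∀ x ∈ Submodule.span ℝ (signedVec '' insert G 𝓣),
        x - δ x • signedVec G ∈ Submodule.span ℝ (signedVec '' 𝓣) := by
  obtain ⟨δ, h1, h0, hi⟩ := h.exists_dual (mem_insert G 𝓣)
  have hz : ∀ x ∈ Submodule.span ℝ (signedVec '' 𝓣), δ x = 0 := by
    intro x hx
    have : Submodule.span ℝ (signedVec '' 𝓣) ≤ LinearMap.ker δ := by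
      rw [Submodule.span_le]
      rintro _ ⟨F, hF, rfl⟩
      exact h0 F (Or.inr hF) fun h => hG (h ▸ hF)
    exact this hx
  refine ⟨δ, h1, hz, hi, fun x hx => ?_⟩
  rw [image_insert_eq, Submodule.mem_span_insert] at hx
  obtain ⟨a, z, hz', rfl⟩ := hx
  rw [map_add, map_smul, h1, hz z hz']
  simpa using hz'

lemma isNormalVector_signedVec (h : AdmChain (insert G 𝓣)) (hG : G ∉ 𝓣) :
    IsNormalVector (flagCone (insert G 𝓣)) (flagCone 𝓣) (signedVec G) := by
  obtain ⟨δ, h1, hz, hi, hd⟩ := exists_dual_insert h hG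
  refine ⟨signedVec_mem_flagCone (mem_insert _ _), le_antisymm (fun x hx => ?_) ?_⟩
  · rw [mem_coneLattice, linSpan_flagCone] at hx
    obtain ⟨m, hm⟩ := hi x hx.2
    have hxm : x = (x - m • signedVec G) + m • signedVec G := by simp
    rw [hxm]
    refine AddSubgroup.add_mem_sup ?_ (AddSubgroup.zsmul_mem_zmultiples _ m)
    rw [mem_coneLattice, linSpan_flagCone]
    refine ⟨?_, fun i => ?_⟩
    · have := hd x hx.1
      rwa [hm, Int.cast_smul_eq_zsmul] at this
    · obtain ⟨p, hp⟩ := hx.2 i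
      obtain ⟨q, hq⟩ := isIntegral_signedVec G i
      exact ⟨p - m * q, by simp [hp, hq]⟩
  · rw [sup_le_iff]
    constructor
    · intro x hx
      rw [mem_coneLattice, linSpan_flagCone] at hx ⊢
      exact ⟨Submodule.span_mono (image_mono (subset_insert _ _)) hx.1, hx.2⟩
    · rw [AddSubgroup.zmultiples_le, mem_coneLattice, linSpan_flagCone]
      exact ⟨Submodule.subset_span ⟨G, mem_insert _ _, rfl⟩, isIntegral_signedVec G⟩

/-- A generator has δ-value ±1, and nonnegativity of δ on the cone leaves only +1. So the choice of
representative does not affect balancing. -/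
lemma IsNormalVector.sub_mem (h : AdmChain (insert G 𝓣)) (hG : G ∉ 𝓣) {v : Fin n → ℝ}
    (hv : IsNormalVector (flagCone (insert G 𝓣)) (flagCone 𝓣) v) :
    v - signedVec G ∈ linSpan (flagCone 𝓣) := by
  obtain ⟨δ, h1, hz, hi, hd⟩ := exists_dual_insert h hG
  have hvl : v ∈ coneLattice (flagCone (insert G 𝓣)) := by
    rw [hv.2]
    exact AddSubgroup.mem_sup_right (AddSubgroup.mem_zmultiples v)
  have hGl : signedVec G ∈ coneLattice (flagCone (insert G 𝓣)) := by
    rw [mem_coneLattice, linSpan_flagCone]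
    exact ⟨Submodule.subset_span ⟨G, mem_insert _ _, rfl⟩, isIntegral_signedVec G⟩
  have hpos : 0 ≤ δ v := by
    refine Submodule.span_induction (p := fun x _ => 0 ≤ δ x) ?_ ?_ ?_ ?_ hv.1
    · rintro _ ⟨F, rfl | hF, rfl⟩
      · rw [h1]; exact zero_le_one
      · rw [hz _ (Submodule.subset_span ⟨F, hF, rfl⟩)]
    · simp
    · intro x y _ _ hx hy
      rw [map_add]; exact add_nonneg hx hy
    · intro a x _ hx
      rw [show δ (a • x) = (a : ℝ) * δ x from map_smul δ (a : ℝ) x]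
      exact mul_nonneg a.2 hx
  obtain ⟨k, hk⟩ := hi v hvl.2
  rw [hv.2, AddSubgroup.mem_sup] at hGl
  obtain ⟨w, hw, _, ⟨m, rfl⟩, hwm⟩ := hGl
  rw [mem_coneLattice, linSpan_flagCone] at hw
  have h2 := congrArg δ hwm
  rw [map_add, hz w hw.1, h1, zero_add] at h2
  change δ (m • v) = 1 at h2
  rw [map_zsmul, hk, zsmul_eq_mul] at h2
  have h3 : m * k = 1 := by exact_mod_cast h2
  rw [hk] at hpos
  have hk0 : 0 ≤ k := by exact_mod_cast hpos
  have hk1 : k = 1 := by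
    rcases Int.eq_one_or_neg_one_of_mul_eq_one' h3 with h | h <;> omega
  rw [mem_coneLattice, linSpan_flagCone] at hvl
  have := hd v hvl.1
  rw [linSpan_flagCone]
  rwa [hk, hk1, Int.cast_one, one_smul] at this

end NormalVector

/-! ### Minkowski weights as functions on flags -/

lemma IsFlag.admChain {𝓕 : Set (Set (J n))} (h : IsFlag M 𝓕) : AdmChain 𝓕 where
  nonempty F hF := nonempty_iff_ne_empty.2 fun he => (h.1 hF).2 (Or.inl he)
  admissible F hF := by
    obtain ⟨h1 | h1, h2⟩ := h.1 hF
    · exact h1.2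
    · exact (h2 (Or.inr h1)).elim
  chain := h.2

lemma IsFlag.isFlat {𝓕 : Set (Set (J n))} (h : IsFlag M 𝓕) {F : Set (J n)} (hF : F ∈ 𝓕) :
    M.IsFlat F := by
  obtain ⟨h1 | h1, h2⟩ := h.1 hF
  · exact h1.1
  · exact (h2 (Or.inr h1)).elim

lemma IsFlag.mono {𝓕 𝓖 : Set (Set (J n))} (h : IsFlag M 𝓖) (hs : 𝓕 ⊆ 𝓖) : IsFlag M 𝓕 :=
  ⟨hs.trans h.1, h.2.mono hs⟩

lemma IsFlag.of_admChain {𝓕 : Set (Set (J n))} (h : AdmChain 𝓕) (hf : ∀ F ∈ 𝓕, M.IsFlat F) :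
    IsFlag M 𝓕 := by
  refine ⟨fun F hF => ⟨Or.inl ⟨hf F hF, h.admissible F hF⟩, ?_⟩, h.chain⟩
  obtain ⟨a, ha⟩ := h.nonempty F hF
  rintro (rfl | rfl)
  · exact ha
  · exact (h.admissible _ hF).star_notMem ha (mem_univ _)

lemma IsFlag.flagCone_mem {𝓕 : Set (Set (J n))} (h : IsFlag M 𝓕) {d : ℕ} (hd : 𝓕.ncard = d) :
    flagCone 𝓕 ∈ conesOfDim (bergmanFan M) d :=
  ⟨⟨𝓕, h, rfl⟩, by rw [h.admChain.coneDim_flagCone, hd]⟩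

/-- The flats that extend a flag to a flag with one more member. -/
noncomputable def extFlats (M : Matroid (J n)) (𝓣 : Set (Set (J n))) : Finset (Set (J n)) :=
  (Set.toFinite {G | G ∉ 𝓣 ∧ IsFlag M (insert G 𝓣)}).toFinset

@[simp] lemma mem_extFlats {𝓣 : Set (Set (J n))} {G : Set (J n)} :
    G ∈ extFlats M 𝓣 ↔ G ∉ 𝓣 ∧ IsFlag M (insert G 𝓣) := by simp [extFlats]

open Classical in
/-- A weight on the `d`-dimensional cones, as a function of the flag. -/
noncomputable def flagWeight {d : ℕ} (c : conesOfDim (bergmanFan M) d → ℤ)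
    (𝓕 : Set (Set (J n))) : ℤ :=
  if h : flagCone 𝓕 ∈ conesOfDim (bergmanFan M) d then c ⟨flagCone 𝓕, h⟩ else 0

/-- A function on the flags of size `d` satisfying the balancing condition. -/
def Balanced (M : Matroid (J n)) (d : ℕ) (f : Set (Set (J n)) → ℤ) : Prop :=
  ∀ 𝓣, IsFlag M 𝓣 → 𝓣.ncard + 1 = d →
    ∑ G ∈ extFlats M 𝓣, f (insert G 𝓣) • signedVec G ∈ Submodule.span ℝ (signedVec '' 𝓣)

/-- The d-dimensional cones containing the cone of 𝓣 are in bijection with the flats that extend 𝓣,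
and each representative agrees with the vector of its flat modulo the span. -/
lemma finsum_star_eq {d : ℕ} (c : conesOfDim (bergmanFan M) d → ℤ) {𝓣 : Set (Set (J n))}
    (h𝓣 : IsFlag M 𝓣) (hd : 𝓣.ncard + 1 = d)
    (e : {σ : conesOfDim (bergmanFan M) d // flagCone 𝓣 ≤ σ.1} → (Fin n → ℝ))
    (he : ∀ σ, IsNormalVector σ.1.1 (flagCone 𝓣) (e σ)) :
    (∑ᶠ σ : {σ : conesOfDim (bergmanFan M) d // flagCone 𝓣 ≤ σ.1}, c σ.1 • e σ) -
      ∑ G ∈ extFlats M 𝓣, flagWeight c (insert G 𝓣) • signedVec G ∈ linSpan (flagCone 𝓣) := by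
  have hfl : ∀ G ∈ extFlats M 𝓣, flagCone (insert G 𝓣) ∈ conesOfDim (bergmanFan M) d := by
    intro G hG
    rw [mem_extFlats] at hG
    exact hG.2.flagCone_mem (by rw [ncard_insert_of_notMem hG.1 (Set.toFinite _), hd])
  let φ : extFlats M 𝓣 → {σ : conesOfDim (bergmanFan M) d // flagCone 𝓣 ≤ σ.1} := fun G =>
    ⟨⟨flagCone (insert G.1 𝓣), hfl G.1 G.2⟩, Submodule.span_mono (image_mono (subset_insert _ _))⟩
  have hφ : Function.Bijective φ := by
    constructor
    · intro G G' h
      have h1 : flagCone (insert G.1 𝓣) = flagCone (insert G'.1 𝓣) :=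
        congrArg (fun x => x.1.1) h
      have hG := mem_extFlats.1 G.2
      have hG' := mem_extFlats.1 G'.2
      have h2 := hG.2.admChain.flagCone_injective hG'.2.admChain h1
      have h3 : G.1 ∈ insert G'.1 𝓣 := h2 ▸ mem_insert _ _
      exact Subtype.ext (h3.resolve_right hG.1)
    · rintro ⟨⟨σ, ⟨𝓕, h𝓕, rfl⟩, hdim⟩, hle⟩
      rw [IsFlag.admChain h𝓕 |>.coneDim_flagCone] at hdim
      have hs := (h𝓣.admChain.flagCone_le_iff (IsFlag.admChain h𝓕)).1 hle
      obtain ⟨G, hG, rfl⟩ := (Set.exists_eq_insert_iff_ncard (Set.toFinite 𝓣)).2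
        ⟨hs, hd.trans hdim.symm⟩
      exact ⟨⟨G, mem_extFlats.2 ⟨hG, h𝓕⟩⟩, rfl⟩
  rw [← finsum_eq_of_bijective φ hφ (f := fun G => c (φ G).1 • e (φ G)) (fun G => rfl),
    finsum_eq_sum_of_fintype,
    ← Finset.sum_coe_sort (extFlats M 𝓣) (fun G => flagWeight c (insert G 𝓣) • signedVec G), ← Finset.sum_sub_distrib]
  refine Submodule.sum_mem _ fun G _ => ?_
  have hw : flagWeight c (insert G.1 𝓣) = c (φ G).1 := by
    rw [flagWeight, dif_pos (hfl G.1 G.2)]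
  rw [hw, ← smul_sub]
  have hG := mem_extFlats.1 G.2
  exact zsmul_mem ((he (φ G)).sub_mem hG.2.admChain hG.1) _

theorem isMinkowskiWeight_iff {d : ℕ} (c : conesOfDim (bergmanFan M) d → ℤ) :
    IsMinkowskiWeight (bergmanFan M) d c ↔ Balanced M d (flagWeight c) := by
  constructor
  · intro h 𝓣 h𝓣 hd
    obtain ⟨e, he, hsum⟩ := h (flagCone 𝓣) ⟨𝓣, h𝓣, rfl⟩
      (by rw [h𝓣.admChain.coneDim_flagCone, hd])
    rw [← linSpan_flagCone]
    exact (Submodule.sub_mem_iff_right _ hsum).1 (finsum_star_eq c h𝓣 hd e he)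
  · rintro h _ ⟨𝓣, h𝓣, rfl⟩ hd
    rw [IsFlag.admChain h𝓣 |>.coneDim_flagCone] at hd
    have hex : ∀ σ : {σ : conesOfDim (bergmanFan M) d // flagCone 𝓣 ≤ σ.1},
        ∃ v, IsNormalVector σ.1.1 (flagCone 𝓣) v := by
      rintro ⟨⟨σ, ⟨𝓕, h𝓕, rfl⟩, hdim⟩, hle⟩
      rw [IsFlag.admChain h𝓕 |>.coneDim_flagCone] at hdim
      have hs := ((IsFlag.admChain h𝓣).flagCone_le_iff (IsFlag.admChain h𝓕)).1 hle
      obtain ⟨G, hG, rfl⟩ := (Set.exists_eq_insert_iff_ncard (Set.toFinite 𝓣)).2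
        ⟨hs, hd.trans hdim.symm⟩
      exact ⟨signedVec G, isNormalVector_signedVec (IsFlag.admChain h𝓕) hG⟩
    choose e he using hex
    refine ⟨e, he, ?_⟩
    have h1 := h 𝓣 h𝓣 hd
    rw [← linSpan_flagCone] at h1
    exact (Submodule.sub_mem_iff_left _ h1).1 (finsum_star_eq c h𝓣 hd e he)

/-! ### Ranks of the members of a flag -/

lemma IsFlag.one_le_rk (hM : IsAdmissibleMatroid M) {𝓕 : Set (Set (J n))} (h : IsFlag M 𝓕)
    {F : Set (J n)} (hF : F ∈ 𝓕) : 1 ≤ rk M F := by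
  have h0 : M.IsFlat ∅ := by
    rw [Matroid.isFlat_iff_closure_eq, hM.closure_empty]
  have := rk_lt_of_ssubset hM.ground_eq h0 (empty_ssubset.2 (h.admChain.nonempty F hF))
  omega

lemma IsFlag.rk_le (hM : IsAdmissibleMatroid M) {d : ℕ} (hr : rk M univ = d + 1)
    {𝓕 : Set (Set (J n))} (h : IsFlag M 𝓕) {F : Set (J n)} (hF : F ∈ 𝓕) : rk M F ≤ d :=
  rk_lt_of_admissible hM.ground_eq hr (h.isFlat hF) (h.admChain.admissible F hF)

lemma IsFlag.subset_of_rk_le (hE : M.E = univ) {𝓕 : Set (Set (J n))} (h : IsFlag M 𝓕)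
    {F G : Set (J n)} (hF : F ∈ 𝓕) (hG : G ∈ 𝓕) (hr : rk M F ≤ rk M G) : F ⊆ G := by
  rcases h.2.total hF hG with hs | hs
  · exact hs
  · exact (eq_of_isFlat_of_rk_le hE (h.isFlat hG) hs hr).ge

lemma IsFlag.eq_of_rk_eq (hE : M.E = univ) {𝓕 : Set (Set (J n))} (h : IsFlag M 𝓕)
    {F G : Set (J n)} (hF : F ∈ 𝓕) (hG : G ∈ 𝓕) (hr : rk M F = rk M G) : F = G :=
  (h.subset_of_rk_le hE hF hG hr.le).antisymm (h.subset_of_rk_le hE hG hF hr.ge)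

/-- A maximal flag has a member of each rank between `1` and `d`. -/
lemma IsFlag.exists_rk_eq (hM : IsAdmissibleMatroid M) {d : ℕ} (hr : rk M univ = d + 1)
    {𝓕 : Set (Set (J n))} (h : IsFlag M 𝓕) (hd : 𝓕.ncard = d) {i : ℕ} (hi : 1 ≤ i)
    (hi' : i ≤ d) : ∃ F ∈ 𝓕, rk M F = i := by
  have hinj : InjOn (rk M) 𝓕 := fun F hF G hG hFG => h.eq_of_rk_eq hM.ground_eq hF hG hFG
  have hsub : rk M '' 𝓕 ⊆ Set.Icc 1 d := by
    rintro _ ⟨F, hF, rfl⟩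
    exact ⟨h.one_le_rk hM hF, h.rk_le hM hr hF⟩
  have heq := Set.eq_of_subset_of_ncard_le hsub (by
    rw [hinj.ncard_image, hd, ← Finset.coe_Icc, Set.ncard_coe_finset, Nat.card_Icc]; simp)
    (Set.finite_Icc 1 d)
  exact heq.ge ⟨hi, hi'⟩

/-! ### Balancing around a flag that misses one rank -/

section Local

variable {d : ℕ} {𝓣 : Set (Set (J n))} {G G' : Set (J n)}

lemma ncard_insert_extFlats (hd : 𝓣.ncard + 1 = d) (hG : G ∈ extFlats M 𝓣) :
    (insert G 𝓣).ncard = d := by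
  rw [ncard_insert_of_notMem (mem_extFlats.1 hG).1 (Set.toFinite _), hd]

/-- Otherwise the flag completed by G would have a member of 𝓣 with the rank of G', and uniqueness
of ranks would force G' ∈ 𝓣. -/
lemma rk_extFlats_eq (hM : IsAdmissibleMatroid M) (hr : rk M univ = d + 1)
    (hd : 𝓣.ncard + 1 = d) (hG : G ∈ extFlats M 𝓣) (hG' : G' ∈ extFlats M 𝓣) :
    rk M G = rk M G' := by
  have h := (mem_extFlats.1 hG).2
  have h' := (mem_extFlats.1 hG').2
  obtain ⟨F, hF | hF, hFr⟩ := h.exists_rk_eq hM hr (ncard_insert_extFlats hd hG)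
    (h'.one_le_rk hM (mem_insert _ _)) (h'.rk_le hM hr (mem_insert _ _))
  · rw [← hF, hFr]
  · exact ((mem_extFlats.1 hG').1
      (h'.eq_of_rk_eq hM.ground_eq (mem_insert_of_mem _ hF) (mem_insert _ _) hFr ▸ hF)).elim

/-- F is the flat just below the gap, with ∅ in this role when the missing rank is 1. -/
lemma exists_pred_extFlats (hM : IsAdmissibleMatroid M) (hr : rk M univ = d + 1)
    (hd : 𝓣.ncard + 1 = d) (hG : G ∈ extFlats M 𝓣) :
    ∃ F, M.IsFlat F ∧ (F = ∅ ∨ F ∈ 𝓣) ∧ rk M F + 1 = rk M G ∧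
      (∀ T ∈ 𝓣, T ⊆ F ∨ ∀ G' ∈ extFlats M 𝓣, G' ⊆ T) ∧ ∀ G' ∈ extFlats M 𝓣, F ⊆ G' := by
  have hE := hM.ground_eq
  have h := (mem_extFlats.1 hG).2
  have hG1 := h.one_le_rk hM (mem_insert _ _)
  have hGd := h.rk_le hM hr (mem_insert _ _)
  rcases hG1.eq_or_lt with h1 | h1
  · refine ⟨∅, ?_, Or.inl rfl, by simpa using h1, fun T hT => Or.inr fun G' hG' => ?_,
      fun _ _ => empty_subset _⟩
    · rw [Matroid.isFlat_iff_closure_eq, hM.closure_empty]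
    · have h' := (mem_extFlats.1 hG').2
      refine h'.subset_of_rk_le hE (mem_insert _ _) (mem_insert_of_mem _ hT) ?_
      rw [← rk_extFlats_eq hM hr hd hG hG', ← h1]
      exact h'.one_le_rk hM (mem_insert_of_mem _ hT)
  · obtain ⟨F, hF, hFr⟩ := h.exists_rk_eq hM hr (ncard_insert_extFlats hd hG)
      (i := rk M G - 1) (by omega) (by omega)
    have hF𝓣 : F ∈ 𝓣 := hF.resolve_left fun h => by rw [h] at hFr; omega
    refine ⟨F, h.isFlat hF, Or.inr hF𝓣, by omega, fun T hT => ?_, fun G' hG' => ?_⟩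
    · rcases le_or_gt (rk M T) (rk M F) with hle | hlt
      · exact Or.inl (h.subset_of_rk_le hE (mem_insert_of_mem _ hT) hF hle)
      · refine Or.inr fun G' hG' => ?_
        refine (mem_extFlats.1 hG').2.subset_of_rk_le hE (mem_insert _ _)
          (mem_insert_of_mem _ hT) ?_
        have := rk_extFlats_eq hM hr hd hG hG'
        omega
    · refine (mem_extFlats.1 hG').2.subset_of_rk_le hE (mem_insert_of_mem _ hF𝓣)
        (mem_insert _ _) ?_
      have := rk_extFlats_eq hM hr hd hG hG'
      omega

lemma extFlats_admissible (hG : G ∈ extFlats M 𝓣) : IsAdmissible G :=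
  (mem_extFlats.1 hG).2.admChain.admissible G (mem_insert _ _)

lemma extFlats_isFlat (hG : G ∈ extFlats M 𝓣) : M.IsFlat G :=
  (mem_extFlats.1 hG).2.isFlat (mem_insert _ _)

/-- A flat that extends 𝓣 and contains a must be cl(F ∪ a), so only the term of G survives. -/
lemma sum_mul_ind (hM : IsAdmissibleMatroid M) (hr : rk M univ = d + 1) (hd : 𝓣.ncard + 1 = d)
    {F : Set (J n)} (hF : M.IsFlat F) (hFG : ∀ G' ∈ extFlats M 𝓣, F ⊆ G')
    (hFr : rk M F + 1 = rk M G) (hG : G ∈ extFlats M 𝓣) {a : J n} (ha : a ∈ G) (haF : a ∉ F)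
    (g : Set (J n) → ℝ) : ∑ G' ∈ extFlats M 𝓣, g G' * ind G' a = g G := by
  rw [Finset.sum_eq_single G _ (fun h => (h hG).elim), ind_of_mem ha, mul_one]
  intro G' hG' hne
  rw [ind_of_notMem, mul_zero]
  intro ha'
  have haF' : a ∉ M.closure F := by rwa [hF.closure]
  have hE := hM.ground_eq
  have h1 := closure_insert_eq_of_rk hE (extFlats_isFlat hG) (hFG G hG) ha haF' hFr.ge
  have h2 := closure_insert_eq_of_rk hE (extFlats_isFlat hG') (hFG G' hG') ha' haF'
    ((rk_extFlats_eq hM hr hd hG' hG).trans hFr.symm).le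
  exact hne (h2.symm.trans h1)

lemma Balanced.sum_eq_zero {f : Set (Set (J n)) → ℤ} (hf : Balanced M d f)
    (h𝓣 : IsFlag M 𝓣) (hd : 𝓣.ncard + 1 = d) (φ : (Fin n → ℝ) →ₗ[ℝ] ℝ)
    (hφ : ∀ T ∈ 𝓣, φ (signedVec T) = 0) :
    ∑ G ∈ extFlats M 𝓣, (f (insert G 𝓣) : ℝ) * φ (signedVec G) = 0 := by
  have h : Submodule.span ℝ (signedVec '' 𝓣) ≤ LinearMap.ker φ := by
    rw [Submodule.span_le]
    rintro _ ⟨T, hT, rfl⟩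
    exact hφ T hT
  have h0 : φ _ = 0 := h (hf 𝓣 h𝓣 hd)
  rw [map_sum] at h0
  rw [← h0]
  refine Finset.sum_congr rfl fun G _ => ?_
  rw [map_zsmul, zsmul_eq_mul]

/-- The values of a balanced function at two flags that differ in a flat below another member of
the flag agree. -/
theorem Balanced.eq_of_subset (hM : IsAdmissibleMatroid M) (hr : rk M univ = d + 1)
    {f : Set (Set (J n)) → ℤ} (hf : Balanced M d f) (hd : 𝓣.ncard + 1 = d)
    (hG : G ∈ extFlats M 𝓣) (hG' : G' ∈ extFlats M 𝓣) {H : Set (J n)} (hH : H ∈ 𝓣)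
    (hGH : G ⊆ H) : f (insert G 𝓣) = f (insert G' 𝓣) := by
  have hE := hM.ground_eq
  have h𝓣 : IsFlag M 𝓣 := (mem_extFlats.1 hG).2.mono (subset_insert _ _)
  have hHad := h𝓣.admChain.admissible H hH
  obtain ⟨F, hF, -, hFr, hT, hFG⟩ := exists_pred_extFlats hM hr hd hG
  have hall : ∀ K ∈ extFlats M 𝓣, K ⊆ H := fun K hK => by
    refine (mem_extFlats.1 hK).2.subset_of_rk_le hE (mem_insert _ _) (mem_insert_of_mem _ hH) ?_
    rw [← rk_extFlats_eq hM hr hd hG hK]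
    exact rk_mono hGH
  have hex : ∀ K ∈ extFlats M 𝓣, ∃ a ∈ K, a ∉ F := by
    intro K hK
    by_contra! hcon
    have := rk_mono (M := M) (show K ⊆ F from hcon)
    have := rk_extFlats_eq hM hr hd hG hK
    omega
  -- The value does not depend on a, so `coord a - coord b` kills the span of 𝓣.
  have hin : ∀ K ∈ extFlats M 𝓣, ∀ a ∈ K, a ∉ F → ∀ T ∈ 𝓣, coord a (signedVec T) =
      (open Classical in if T ⊆ F then 0 else 1) := by
    intro K hK a ha haF T hT'
    split_ifs with hTF
    · exact coord_signedVec_of_notMem (fun h => haF (hTF h))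
        fun h => (extFlats_admissible hK).star_notMem ha (hFG K hK (hTF h))
    · exact coord_signedVec_of_mem (h𝓣.admChain.admissible T hT')
        (((hT T hT').resolve_left hTF) K hK ha)
  -- All extensions lie in the admissible set H, so the starred term vanishes.
  have hco : ∀ K ∈ extFlats M 𝓣, ∀ a ∈ K, ∀ L ∈ extFlats M 𝓣,
      coord a (signedVec L) = ind L a := by
    intro K hK a ha L hL
    rw [coord_signedVec, ind_of_notMem (a := star a), sub_zero]
    exact fun h => hHad.star_notMem (hall K hK ha) (hall L hL h)
  obtain ⟨a, ha, haF⟩ := hex G hG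
  obtain ⟨b, hb, hbF⟩ := hex G' hG'
  have h0 := hf.sum_eq_zero h𝓣 hd (coord a - coord b) fun T hT' => by
    rw [LinearMap.sub_apply, hin G hG a ha haF T hT', hin G' hG' b hb hbF T hT', sub_self]
  have h1 := sum_mul_ind hM hr hd hF hFG hFr hG ha haF (fun K => (f (insert K 𝓣) : ℝ))
  have h2 := sum_mul_ind hM hr hd hF hFG (hFr.trans (rk_extFlats_eq hM hr hd hG hG')) hG' hb hbF
    (fun K => (f (insert K 𝓣) : ℝ))
  have h3 : ∑ K ∈ extFlats M 𝓣, (f (insert K 𝓣) : ℝ) * (coord a - coord b) (signedVec K) =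
      f (insert G 𝓣) - f (insert G' 𝓣) := by
    rw [← h1, ← h2, ← Finset.sum_sub_distrib]
    refine Finset.sum_congr rfl fun K hK => ?_
    rw [LinearMap.sub_apply, hco G hG a ha K hK, hco G' hG' b hb K hK, mul_sub]
  rw [h3] at h0
  exact_mod_cast sub_eq_zero.1 h0

/-- The values of a balanced function at two flags whose top flats contain `a` and `a*`,
respectively, and which agree below, are equal. -/
theorem Balanced.eq_of_star (hM : IsAdmissibleMatroid M) (hr : rk M univ = d + 1)
    {f : Set (Set (J n)) → ℤ} (hf : Balanced M d f) (hd : 𝓣.ncard + 1 = d)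
    (hG : G ∈ extFlats M 𝓣) (hG' : G' ∈ extFlats M 𝓣) {a : J n} (ha : a ∈ G)
    (ha' : star a ∈ G') (h1 : ∀ T ∈ 𝓣, a ∉ T) (h2 : ∀ T ∈ 𝓣, star a ∉ T) :
    f (insert G 𝓣) = f (insert G' 𝓣) := by
  have h𝓣 : IsFlag M 𝓣 := (mem_extFlats.1 hG).2.mono (subset_insert _ _)
  obtain ⟨F, hF, hF', hFr, hT, hFG⟩ := exists_pred_extFlats hM hr hd hG
  have haF : a ∉ F := by
    rcases hF' with rfl | h
    exacts [notMem_empty _, h1 F h]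
  have haF' : star a ∉ F := by
    rcases hF' with rfl | h
    exacts [notMem_empty _, h2 F h]
  have h0 := hf.sum_eq_zero h𝓣 hd (coord a) fun T hT' =>
    coord_signedVec_of_notMem (h1 T hT') (h2 T hT')
  have e1 := sum_mul_ind hM hr hd hF hFG hFr hG ha haF (fun K => (f (insert K 𝓣) : ℝ))
  have e2 := sum_mul_ind hM hr hd hF hFG (hFr.trans (rk_extFlats_eq hM hr hd hG hG')) hG' ha' haF'
    (fun K => (f (insert K 𝓣) : ℝ))
  have h3 : ∑ K ∈ extFlats M 𝓣, (f (insert K 𝓣) : ℝ) * coord a (signedVec K) =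
      f (insert G 𝓣) - f (insert G' 𝓣) := by
    rw [← e1, ← e2, ← Finset.sum_sub_distrib]
    refine Finset.sum_congr rfl fun K hK => ?_
    rw [coord_signedVec, mul_sub]
  rw [h3] at h0
  exact_mod_cast sub_eq_zero.1 h0

lemma closure_insert_mem_extFlats (hM : IsAdmissibleMatroid M)
    (hG : G ∈ extFlats M 𝓣) {F : Set (J n)} (hF : M.IsFlat F)
    (hFr : rk M F + 1 = rk M G) {a : J n} (ha : a ∉ F)
    (hadm : IsAdmissible (M.closure (insert a F)))
    (hT : ∀ T ∈ 𝓣, T ⊆ F ∨ M.closure (insert a F) ⊆ T) :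
    M.closure (insert a F) ∈ extFlats M 𝓣 := by
  have hE := hM.ground_eq
  have hfl := (mem_extFlats.1 hG).2
  have h𝓣 : IsFlag M 𝓣 := hfl.mono (subset_insert _ _)
  have hs := subset_closure_self hE (insert a F)
  rw [mem_extFlats]
  constructor
  · intro h
    have : M.closure (insert a F) = G := hfl.eq_of_rk_eq hE (mem_insert_of_mem _ h)
      (mem_insert _ _) (by rw [rk_closure, rk_insert_of_notMem hE (by rwa [hF.closure]), hFr])
    exact (mem_extFlats.1 hG).1 (this ▸ h)
  · refine IsFlag.of_admChain ⟨?_, ?_, ?_⟩ ?_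
    · rintro T (rfl | h)
      · exact ⟨a, hs (mem_insert _ _)⟩
      · exact h𝓣.admChain.nonempty T h
    · rintro T (rfl | h)
      · exact hadm
      · exact h𝓣.admChain.admissible T h
    · refine h𝓣.2.insert fun T h _ => ?_
      exact (hT T h).symm.imp_right fun h => h.trans ((subset_insert _ _).trans hs)
    · rintro T (rfl | h)
      · exact M.isFlat_closure _
      · exact h𝓣.isFlat h

/-- Sufficient condition for balancing. -/
theorem balanced_of_local (hM : IsAdmissibleMatroid M) (hr : rk M univ = d + 1)
    {f : Set (Set (J n)) → ℤ}
    (h1 : ∀ 𝓣, 𝓣.ncard + 1 = d → ∀ G ∈ extFlats M 𝓣, ∀ G' ∈ extFlats M 𝓣, ∀ H ∈ 𝓣,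
      G ⊆ H → G' ⊆ H → f (insert G 𝓣) = f (insert G' 𝓣))
    (h2 : ∀ 𝓣, 𝓣.ncard + 1 = d → ∀ G ∈ extFlats M 𝓣, ∀ G' ∈ extFlats M 𝓣,
      (∀ T ∈ 𝓣, T ⊆ G) → (∀ T ∈ 𝓣, T ⊆ G') → ∀ a ∈ G, star a ∈ G' →
        f (insert G 𝓣) = f (insert G' 𝓣)) : Balanced M d f := by
  intro 𝓣 h𝓣 hd
  have hE := hM.ground_eq
  by_cases hne : (extFlats M 𝓣).Nonempty
  swap
  · rw [Finset.not_nonempty_iff_eq_empty.1 hne, Finset.sum_empty]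
    exact zero_mem _
  obtain ⟨G, hG⟩ := hne
  have hfl := (mem_extFlats.1 hG).2
  obtain ⟨F, hF, hF', hFr, hT, hFG⟩ := exists_pred_extFlats hM hr hd hG
  have heF : signedVec F ∈ Submodule.span ℝ (signedVec '' 𝓣) := by
    rcases hF' with rfl | h
    · rw [signedVec_empty]; exact zero_mem _
    · exact Submodule.subset_span ⟨F, h, rfl⟩
  -- The vector of F already lies in the span, so only the parts K \ F matter. Below, `D a` is, for
  -- a ∉ F, the weight of the unique extension through a, or 0 if there is none.
  have hsplit : ∑ K ∈ extFlats M 𝓣, f (insert K 𝓣) • signedVec K =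
      ∑ K ∈ extFlats M 𝓣, f (insert K 𝓣) • (signedVec K - signedVec F) +
        (∑ K ∈ extFlats M 𝓣, f (insert K 𝓣)) • signedVec F := by
    rw [Finset.sum_smul, ← Finset.sum_add_distrib]
    simp [smul_sub]
  rw [hsplit]
  refine add_mem ?_ (zsmul_mem heF _)
  let D : J n → ℝ := fun a => ∑ K ∈ extFlats M 𝓣, (f (insert K 𝓣) : ℝ) * (ind K a - ind F a)
  have hD : ∀ a, coord a (∑ K ∈ extFlats M 𝓣, f (insert K 𝓣) • (signedVec K - signedVec F)) =
      D a - D (star a) := by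
    intro a
    rw [map_sum, ← Finset.sum_sub_distrib]
    refine Finset.sum_congr rfl fun K _ => ?_
    rw [map_zsmul, map_sub, coord_signedVec, coord_signedVec, zsmul_eq_mul]
    ring
  have hDF : ∀ a ∈ F, D a = 0 := fun a ha => Finset.sum_eq_zero fun K hK => by
    rw [ind_of_mem ha, ind_of_mem (hFG K hK ha), sub_self, mul_zero]
  have hDn : ∀ a, a ∉ F → (∀ K ∈ extFlats M 𝓣, a ∉ K) → D a = 0 := fun a ha hK =>
    Finset.sum_eq_zero fun K hK' => by
      rw [ind_of_notMem ha, ind_of_notMem (hK K hK'), sub_self, mul_zero]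
  have hDm : ∀ a, a ∉ F → ∀ K ∈ extFlats M 𝓣, a ∈ K → D a = f (insert K 𝓣) := by
    intro a ha K hK haK
    rw [← sum_mul_ind hM hr hd hF hFG (hFr.trans (rk_extFlats_eq hM hr hd hG hK)) hK haK ha
      (fun K => (f (insert K 𝓣) : ℝ))]
    refine Finset.sum_congr rfl fun K _ => ?_
    rw [ind_of_notMem ha, sub_zero]
  by_cases hup : ∃ T ∈ 𝓣, G ⊆ T
  · obtain ⟨T, hT𝓣, hGT⟩ := hup
    have hlt : rk M G < rk M T := rk_lt_of_ssubset hE (extFlats_isFlat hG)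
      (hGT.ssubset_of_ne fun h => (mem_extFlats.1 hG).1 (h ▸ hT𝓣))
    have hTd := h𝓣.rk_le hM hr hT𝓣
    obtain ⟨H, hH, hHr⟩ := hfl.exists_rk_eq hM hr (ncard_insert_extFlats hd hG)
      (i := rk M G + 1) (by omega) (by omega)
    have hH𝓣 : H ∈ 𝓣 := hH.resolve_left fun h => by rw [h] at hHr; omega
    have hHad := h𝓣.admChain.admissible H hH𝓣
    have hall : ∀ K ∈ extFlats M 𝓣, K ⊆ H := fun K hK => by
      refine (mem_extFlats.1 hK).2.subset_of_rk_le hE (mem_insert _ _)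
        (mem_insert_of_mem _ hH𝓣) ?_
      have := rk_extFlats_eq hM hr hd hG hK
      omega
    -- The extensions cover H \ F and have equal weights by `h1`, so the sum is a multiple of the
    -- vector of H minus that of F.
    have hDH : ∀ a, D a = f (insert G 𝓣) * (ind H a - ind F a) := by
      intro a
      by_cases haF : a ∈ F
      · rw [hDF a haF, ind_of_mem haF, ind_of_mem (hall G hG (hFG G hG haF)), sub_self, mul_zero]
      by_cases haH : a ∈ H
      · have hsub : M.closure (insert a F) ⊆ H := closure_subset_of_isFlat (h𝓣.isFlat hH𝓣)
          (insert_subset haH ((hFG G hG).trans (hall G hG)))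
        have hK := closure_insert_mem_extFlats hM hG hF hFr haF (hHad.subset hsub)
          fun T hT' => (hT T hT').imp_right fun h => by
            refine hsub.trans (h𝓣.subset_of_rk_le hE hH𝓣 hT' ?_)
            have := rk_lt_of_ssubset hE (extFlats_isFlat hG)
              ((h G hG).ssubset_of_ne fun h => (mem_extFlats.1 hG).1 (h ▸ hT'))
            omega
        rw [hDm a haF _ hK (subset_closure_self hE _ (mem_insert _ _)), ind_of_mem haH,
          ind_of_notMem haF, sub_zero, mul_one, h1 𝓣 hd _ hK G hG H hH𝓣 hsub (hall G hG)]
      · rw [hDn a haF fun K hK h => haH (hall K hK h), ind_of_notMem haF, ind_of_notMem haH,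
          sub_self, mul_zero]
    have heq : ∑ K ∈ extFlats M 𝓣, f (insert K 𝓣) • (signedVec K - signedVec F) =
        f (insert G 𝓣) • (signedVec H - signedVec F) := by
      refine eq_of_coord_eq fun a => ?_
      rw [hD, hDH, hDH, map_zsmul, map_sub, coord_signedVec, coord_signedVec, zsmul_eq_mul]
      ring
    rw [heq]
    exact zsmul_mem (sub_mem (Submodule.subset_span (mem_image_of_mem _ hH𝓣)) heF) _
  · have hTF : ∀ T ∈ 𝓣, T ⊆ F := fun T hT' =>
      (hT T hT').resolve_right fun h => hup ⟨T, hT', h G hG⟩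
    -- With the top missing, cl(F ∪ a*) is an extension whenever cl(F ∪ a) is; by `h2` the
    -- contributions at a and a* cancel.
    have hflip : ∀ a, a ∉ F → star a ∉ F → ∀ K ∈ extFlats M 𝓣, a ∈ K → D a = D (star a) := by
      intro a ha ha' K hK haK
      have haF : a ∉ M.closure F := by rwa [hF.closure]
      have haF' : star a ∉ M.closure F := by rwa [hF.closure]
      have hKeq := closure_insert_eq_of_rk hE (extFlats_isFlat hK) (hFG K hK) haK haF
        (by rw [rk_extFlats_eq hM hr hd hK hG, hFr])
      have hadm := hM.admissible_closure_insert_star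
        (by rw [hKeq]; exact extFlats_admissible hK) haF haF'
      have hK' := closure_insert_mem_extFlats hM hG hF hFr ha' hadm
        fun T hT' => Or.inl (hTF T hT')
      have hmem : star a ∈ M.closure (insert (star a) F) :=
        subset_closure_self hE _ (mem_insert _ _)
      rw [hDm a ha K hK haK, hDm (star a) ha' _ hK' hmem,
        h2 𝓣 hd K hK _ hK' (fun T hT' => (hTF T hT').trans (hFG K hK))
          (fun T hT' => (hTF T hT').trans (hFG _ hK')) a haK hmem]
    have heq : ∑ K ∈ extFlats M 𝓣, f (insert K 𝓣) • (signedVec K - signedVec F) = 0 := by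
      refine eq_of_coord_eq fun a => ?_
      rw [hD, map_zero, sub_eq_zero]
      have hFad := (extFlats_admissible hG).subset (hFG G hG)
      by_cases ha : a ∈ F
      · rw [hDF a ha, hDn _ (hFad.star_notMem ha)
          fun K hK => (extFlats_admissible hK).star_notMem (hFG K hK ha)]
      by_cases ha' : star a ∈ F
      · rw [hDF _ ha', hDn _ ha
          fun K hK => (extFlats_admissible hK).notMem_of_star (hFG K hK ha')]
      by_cases hK : ∃ K ∈ extFlats M 𝓣, a ∈ K
      · obtain ⟨K, hK, haK⟩ := hK
        exact hflip a ha ha' K hK haK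
      by_cases hK' : ∃ K ∈ extFlats M 𝓣, star a ∈ K
      · obtain ⟨K, hK', haK⟩ := hK'
        have := hflip (star a) ha' (by rwa [star_star]) K hK' haK
        rw [star_star] at this
        exact this.symm
      push Not at hK hK'
      rw [hDn a ha hK, hDn _ ha' hK']
    rw [heq]
    exact zero_mem _

end Local

/-! ### Flags of lists, and moves that preserve a balanced function -/

/-- The flag of the closures of the nonempty suffixes of a list. -/
def flagOf (M : Matroid (J n)) : List (J n) → Set (Set (J n))
  | [] => ∅
  | a :: l => insert (cl M (a :: l)) (flagOf M l)

/-- An independent list whose closure is admissible. -/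
def AdmList (M : Matroid (J n)) (l : List (J n)) : Prop :=
  IndepList M l ∧ IsAdmissible (cl M l)

lemma AdmList.perm {l l' : List (J n)} (h : AdmList M l) (hp : l.Perm l') : AdmList M l' :=
  ⟨h.1.perm hp, cl_perm (M := M) hp ▸ h.2⟩

lemma AdmList.of_cons (hE : M.E = univ) {a : J n} {l : List (J n)} (h : AdmList M (a :: l)) :
    AdmList M l :=
  ⟨((indepList_cons hE).1 h.1).2, h.2.subset (cl_subset_cl_cons a l)⟩

lemma AdmList.notMem (hE : M.E = univ) {a : J n} {l : List (J n)} (h : AdmList M (a :: l)) :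
    a ∉ cl M l := ((indepList_cons hE).1 h.1).1

lemma AdmList.star_notMem (hE : M.E = univ) {a : J n} {l : List (J n)}
    (h : AdmList M (a :: l)) : star a ∉ cl M l := fun h' =>
  h.2.star_notMem (mem_cl hE (by simp)) (cl_subset_cl_cons a l h')

lemma cl_ssubset_cl_cons (hE : M.E = univ) {a : J n} {l : List (J n)} (h : AdmList M (a :: l)) :
    cl M l ⊂ cl M (a :: l) :=
  (ssubset_iff_of_subset (cl_subset_cl_cons a l)).2 ⟨a, mem_cl hE (by simp), h.notMem hE⟩

lemma subset_cl_of_mem_flagOf {l : List (J n)} {F : Set (J n)} (hF : F ∈ flagOf M l) :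
    F ⊆ cl M l := by
  induction l with
  | nil => exact hF.elim
  | cons a l ih =>
    rcases hF with rfl | hF
    · exact subset_rfl
    · exact (ih hF).trans (cl_subset_cl_cons a l)

/-- Hands the top flat of the list over to 𝓤, so that inductions can peel off the head while 𝓤 keeps
the flats above. -/
lemma flagOf_cons_union (a : J n) (l : List (J n)) (𝓤 : Set (Set (J n))) :
    flagOf M (a :: l) ∪ 𝓤 = flagOf M l ∪ insert (cl M (a :: l)) 𝓤 := by
  rw [flagOf, insert_union, union_insert]

lemma IsFlag.insert_cl (hE : M.E = univ) {a : J n} {l : List (J n)} {𝓤 : Set (Set (J n))}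
    (h𝓤 : IsFlag M 𝓤) (hl : AdmList M (a :: l)) (hab : ∀ U ∈ 𝓤, cl M (a :: l) ⊂ U) :
    IsFlag M (insert (cl M (a :: l)) 𝓤) ∧
      (insert (cl M (a :: l)) 𝓤).ncard = 𝓤.ncard + 1 ∧
      ∀ U ∈ insert (cl M (a :: l)) 𝓤, cl M l ⊂ U := by
  refine ⟨IsFlag.of_admChain ⟨?_, ?_, ?_⟩ ?_, ?_, ?_⟩
  · rintro U (rfl | hU)
    · exact ⟨a, mem_cl hE (by simp)⟩
    · exact h𝓤.admChain.nonempty U hU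
  · rintro U (rfl | hU)
    · exact hl.2
    · exact h𝓤.admChain.admissible U hU
  · exact h𝓤.2.insert fun U hU _ => Or.inl (hab U hU).subset
  · rintro U (rfl | hU)
    · exact M.isFlat_closure _
    · exact h𝓤.isFlat hU
  · exact ncard_insert_of_notMem (fun h => (hab _ h).ne rfl) (Set.toFinite _)
  · rintro U (rfl | hU)
    · exact cl_ssubset_cl_cons hE hl
    · exact (cl_ssubset_cl_cons hE hl).trans (hab U hU)

lemma isFlag_flagOf_union (hE : M.E = univ) {l : List (J n)} (hl : AdmList M l)
    {𝓤 : Set (Set (J n))} (h𝓤 : IsFlag M 𝓤) (hab : ∀ U ∈ 𝓤, cl M l ⊂ U) :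
    IsFlag M (flagOf M l ∪ 𝓤) ∧ (flagOf M l ∪ 𝓤).ncard = l.length + 𝓤.ncard := by
  induction l generalizing 𝓤 with
  | nil => simpa [flagOf] using h𝓤
  | cons a l ih =>
    obtain ⟨h1, h2, h3⟩ := h𝓤.insert_cl hE hl hab
    obtain ⟨h4, h5⟩ := ih (hl.of_cons hE) h1 h3
    rw [flagOf_cons_union]
    refine ⟨h4, ?_⟩
    rw [h5, h2, List.length_cons]
    omega

lemma isFlag_empty : IsFlag M ∅ := ⟨empty_subset _, IsChain.empty⟩

lemma isFlag_flagOf (hE : M.E = univ) {l : List (J n)} (hl : AdmList M l) :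
    IsFlag M (flagOf M l) ∧ (flagOf M l).ncard = l.length := by
  simpa using isFlag_flagOf_union hE hl isFlag_empty (by simp)

lemma mem_extFlats_of_ncard {d : ℕ} {𝓣 : Set (Set (J n))} {G : Set (J n)}
    (h : IsFlag M (insert G 𝓣)) (hc : (insert G 𝓣).ncard = d) (hd : 𝓣.ncard + 1 = d) :
    G ∈ extFlats M 𝓣 := by
  refine mem_extFlats.2 ⟨fun hG => ?_, h⟩
  rw [insert_eq_of_mem hG] at hc
  omega

section Balanced

variable {d : ℕ} {f : Set (Set (J n)) → ℤ}

/-- Swapping two adjacent entries alters a single flat and keeps the one above it, so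
`Balanced.eq_of_subset` applies. The set 𝓤 is carried along for the entries preceding the swap. -/
lemma Balanced.flagOf_perm_union (hM : IsAdmissibleMatroid M) (hr : rk M univ = d + 1)
    (hf : Balanced M d f) {l l' : List (J n)} (hp : l.Perm l') (hl : AdmList M l)
    {𝓤 : Set (Set (J n))} (h𝓤 : IsFlag M 𝓤) (hab : ∀ U ∈ 𝓤, cl M l ⊂ U)
    (hd : l.length + 𝓤.ncard = d) : f (flagOf M l ∪ 𝓤) = f (flagOf M l' ∪ 𝓤) := by
  have hE := hM.ground_eq
  induction hp generalizing 𝓤 with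
  | nil => rfl
  | cons a hp ih =>
    obtain ⟨h1, h2, h3⟩ := h𝓤.insert_cl hE hl hab
    rw [flagOf_cons_union, flagOf_cons_union, ← cl_perm (M := M) (hp.cons a)]
    refine ih (hl.of_cons hE) h1 h3 ?_
    rw [h2, ← hd, List.length_cons]
    omega
  | swap x y l =>
    have hl' := hl.perm (List.Perm.swap x y l)
    have hcl := cl_perm (M := M) (List.Perm.swap x y l)
    obtain ⟨h1, h2, h3⟩ := h𝓤.insert_cl hE hl hab
    have h3' : ∀ U ∈ insert (cl M (y :: x :: l)) 𝓤, cl M (y :: l) ⊂ U := by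
      rw [hcl] at hab ⊢
      exact (h𝓤.insert_cl hE hl' hab).2.2
    have hx := isFlag_flagOf_union hE (hl.of_cons hE) h1 h3
    have hy := isFlag_flagOf_union hE (hl'.of_cons hE) h1 h3'
    have ht := isFlag_flagOf_union hE ((hl.of_cons hE).of_cons hE) h1
      fun U hU => (cl_ssubset_cl_cons hE (hl.of_cons hE)).trans (h3 U hU)
    have e1 : flagOf M (y :: x :: l) ∪ 𝓤 =
        insert (cl M (x :: l)) (flagOf M l ∪ insert (cl M (y :: x :: l)) 𝓤) := by
      rw [flagOf_cons_union, flagOf, insert_union]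
    have e2 : flagOf M (x :: y :: l) ∪ 𝓤 =
        insert (cl M (y :: l)) (flagOf M l ∪ insert (cl M (y :: x :: l)) 𝓤) := by
      rw [flagOf_cons_union, flagOf, insert_union, hcl]
    simp only [flagOf, insert_union, List.length_cons] at hx hy ht hd
    have hd' : (flagOf M l ∪ insert (cl M (y :: x :: l)) 𝓤).ncard + 1 = d := by omega
    rw [e1, e2]
    exact hf.eq_of_subset hM hr hd' (mem_extFlats_of_ncard hx.1 (by omega) hd')
      (mem_extFlats_of_ncard hy.1 (by omega) hd')
      (Or.inr (mem_insert _ _)) (cl_subset_cl_cons _ _)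
  | trans hp hp' ih ih' =>
    exact (ih hl h𝓤 hab hd).trans (ih' (hl.perm hp) h𝓤 (cl_perm (M := M) hp ▸ hab)
      (hp.length_eq ▸ hd))

lemma Balanced.flagOf_perm (hM : IsAdmissibleMatroid M) (hr : rk M univ = d + 1)
    (hf : Balanced M d f) {l l' : List (J n)} (hp : l.Perm l') (hl : AdmList M l)
    (hd : l.length = d) : f (flagOf M l) = f (flagOf M l') := by
  simpa using hf.flagOf_perm_union hM hr hp hl isFlag_empty (by simp) (by simpa using hd)

/-- The head enters only the top flat, so no other member of the flag changes. -/
lemma Balanced.flagOf_star (hM : IsAdmissibleMatroid M) (hr : rk M univ = d + 1)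
    (hf : Balanced M d f) {a : J n} {l : List (J n)} (hl : AdmList M (a :: l))
    (hd : l.length + 1 = d) :
    AdmList M (star a :: l) ∧ f (flagOf M (a :: l)) = f (flagOf M (star a :: l)) := by
  have hE := hM.ground_eq
  have hl' : AdmList M (star a :: l) := by
    refine ⟨(indepList_cons hE).2 ⟨hl.star_notMem hE, (hl.of_cons hE).1⟩, ?_⟩
    have := hl.2
    rw [cl, setOf_mem_cons] at this ⊢
    exact hM.admissible_closure_insert_star this (hl.notMem hE) (hl.star_notMem hE)
  refine ⟨hl', ?_⟩
  have h1 := isFlag_flagOf hE hl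
  have h2 := isFlag_flagOf hE hl'
  have h3 := isFlag_flagOf hE (hl.of_cons hE)
  rw [flagOf, List.length_cons, hd] at h1 h2
  have hd' : (flagOf M l).ncard + 1 = d := by omega
  exact hf.eq_of_star hM hr hd' (mem_extFlats_of_ncard h1.1 h1.2 hd')
    (mem_extFlats_of_ncard h2.1 h2.2 hd') (mem_cl hE (by simp)) (mem_cl hE (by simp))
    (fun T hT h => hl.notMem hE (subset_cl_of_mem_flagOf hT h))
    (fun T hT h => hl.star_notMem hE (subset_cl_of_mem_flagOf hT h))

/-- Steinitz exchange that keeps s. Entries of l are moved into s until b becomes dependent; the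
entry that causes this can be removed. -/
lemma exists_exchange (hE : M.E = univ) {l s : List (J n)} (hl : IndepList M (l ++ s)) {b : J n}
    (hb : b ∈ cl M (l ++ s)) (hbs : b ∉ cl M s) :
    ∃ a l₀, l.Perm (a :: l₀) ∧ b ∉ cl M (l₀ ++ s) := by
  induction l generalizing s with
  | nil => exact (hbs hb).elim
  | cons c l ih =>
    by_cases hc : b ∈ cl M (c :: s)
    · refine ⟨c, l, List.Perm.refl _, fun hbl => ?_⟩
      rw [cl, setOf_mem_cons] at hc
      have h1 := (Matroid.closure_exchange ⟨hc, hbs⟩).1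
      refine ((indepList_cons hE).1 hl).1 (closure_subset_of_isFlat (M.isFlat_closure _) ?_ h1)
      refine insert_subset hbl fun x hx => mem_cl hE (List.mem_append_right _ hx)
    · have hp : (c :: l ++ s).Perm (l ++ c :: s) := List.perm_middle.symm
      obtain ⟨a, l₀, h1, h2⟩ := ih (hl.perm hp) (cl_perm (M := M) hp ▸ hb) hc
      refine ⟨a, c :: l₀, (h1.cons c).trans (List.Perm.swap _ _ _), ?_⟩
      rwa [cl_perm (M := M) (List.perm_middle (a := c) (l₁ := l₀) (l₂ := s))] at h2

/-- Basis exchange with s as the part already shared. An entry a is brought to the head and replaced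
there by b, which leaves every closure in the flag unchanged; then b joins s. -/
lemma Balanced.flagOf_append_eq (hM : IsAdmissibleMatroid M) (hr : rk M univ = d + 1)
    (hf : Balanced M d f) {l' l s : List (J n)} (hl : AdmList M (l ++ s))
    (hl' : AdmList M (l' ++ s)) (hcl : cl M (l ++ s) = cl M (l' ++ s))
    (hd : (l ++ s).length = d) : f (flagOf M (l ++ s)) = f (flagOf M (l' ++ s)) := by
  have hE := hM.ground_eq
  have hlen : (l ++ s).length = (l' ++ s).length := by
    rw [← hl.1.rk_cl, hcl, hl'.1.rk_cl]
  induction l' generalizing l s with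
  | nil =>
    have : l = [] := List.length_eq_zero_iff.1 (by simpa using hlen)
    rw [this]
  | cons b l' ih =>
    have hp' : (b :: l' ++ s).Perm (l' ++ b :: s) := List.perm_middle.symm
    have hbs : b ∉ cl M s := fun h => hl'.notMem hE
      (M.closure_subset_closure (fun x hx => List.mem_append_right _ hx) h)
    have hb : b ∈ cl M (l ++ s) := hcl ▸ mem_cl hE (by simp)
    obtain ⟨a, l₀, hp, hb₀⟩ := exists_exchange hE hl.1 hb hbs
    have hps : (l ++ s).Perm (a :: (l₀ ++ s)) := hp.append_right s
    have hla := hl.perm hps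
    have hclb : cl M (b :: (l₀ ++ s)) = cl M (a :: (l₀ ++ s)) := by
      rw [cl, setOf_mem_cons]
      refine closure_insert_eq_of_rk hE (M.isFlat_closure _)
        (fun x hx => mem_cl hE (List.mem_cons_of_mem _ hx)) (cl_perm (M := M) hps ▸ hb) hb₀ ?_
      rw [rk_closure, setOf_mem_cons, rk_insert_of_notMem hE (hla.notMem hE)]
    have hlb : AdmList M (b :: (l₀ ++ s)) :=
      ⟨(indepList_cons hE).2 ⟨hb₀, (hla.of_cons hE).1⟩, hclb ▸ hla.2⟩
    have hpb : (b :: (l₀ ++ s)).Perm (l₀ ++ b :: s) := List.perm_middle.symm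
    have hdb : (b :: (l₀ ++ s)).length = d := by
      rw [← hd, hps.length_eq, List.length_cons, List.length_cons]
    have hfl : flagOf M (a :: (l₀ ++ s)) = flagOf M (b :: (l₀ ++ s)) := by
      rw [flagOf, flagOf, hclb]
    rw [hf.flagOf_perm hM hr hps hl hd, hfl, hf.flagOf_perm hM hr hpb hlb hdb,
      hf.flagOf_perm hM hr hp' hl' (hlen ▸ hd)]
    refine ih (hlb.perm hpb) (hl'.perm hp') ?_ ?_ ?_
    · rw [← cl_perm (M := M) hpb, ← cl_perm (M := M) hp', hclb, ← cl_perm (M := M) hps, hcl]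
    · rw [← hpb.length_eq, hdb]
    · rw [← hpb.length_eq, hdb, ← hp'.length_eq, ← hlen, hd]

/-- The value of a balanced function at a maximal flag only depends on the top flat. -/
lemma Balanced.flagOf_eq_of_cl_eq (hM : IsAdmissibleMatroid M) (hr : rk M univ = d + 1)
    (hf : Balanced M d f) {l l' : List (J n)} (hl : AdmList M l) (hl' : AdmList M l')
    (hcl : cl M l = cl M l') (hd : l.length = d) : f (flagOf M l) = f (flagOf M l') := by
  have := hf.flagOf_append_eq hM hr (l := l) (l' := l') (s := []) (by simpa using hl)
    (by simpa using hl') (by simpa using hcl) (by simpa using hd)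
  simpa using this

/-- Each entry of q is brought to the head, starred if it lies outside the top flat of m, and moved
to p. Once q is exhausted, p is a basis of that flat. -/
lemma Balanced.flagOf_eq_of_subset (hM : IsAdmissibleMatroid M) (hr : rk M univ = d + 1)
    (hf : Balanced M d f) {m q p : List (J n)} (hm : AdmList M m) (hmd : m.length = d)
    (hpq : AdmList M (p ++ q)) (hd : (p ++ q).length = d) (hp : ∀ x ∈ p, x ∈ cl M m)
    (hq : ∀ x ∈ q, x ∈ cl M m ∪ starSet (cl M m)) :
    f (flagOf M (p ++ q)) = f (flagOf M m) := by
  have hE := hM.ground_eq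
  induction q generalizing p with
  | nil =>
    refine hf.flagOf_eq_of_cl_eq hM hr hpq hm ?_ hd
    refine eq_of_isFlat_of_rk_le hE (M.isFlat_closure _) ?_ ?_
    · exact closure_subset_of_isFlat (M.isFlat_closure _) fun x hx => hp x (by simpa using hx)
    · rw [hm.1.rk_cl, hpq.1.rk_cl, hd, hmd]
  | cons a q ih =>
    have hperm : (p ++ a :: q).Perm (a :: (p ++ q)) := List.perm_middle
    have ha := hpq.perm hperm
    have hq' : ∀ x ∈ q, x ∈ cl M m ∪ starSet (cl M m) := fun x hx => hq x (by simp [hx])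
    rw [hf.flagOf_perm hM hr hperm hpq hd]
    have hd' : (p ++ q).length + 1 = d := by
      rw [← hd, hperm.length_eq, List.length_cons]
    by_cases haF : a ∈ cl M m
    · refine ih (p := a :: p) ha hd' ?_ hq'
      simpa [haF] using hp
    · have haF' : star a ∈ cl M m := by
        have := (hq a (by simp)).resolve_left haF
        simpa using this
      obtain ⟨h1, h2⟩ := hf.flagOf_star hM hr ha hd'
      rw [h2]
      refine ih (p := star a :: p) h1 hd' ?_ hq'
      simpa [haF'] using hp

end Balanced

/-! ### Weights and linked cones -/

/-- Every maximal flag comes from a list. -/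
lemma IsFlag.exists_list (hM : IsAdmissibleMatroid M) {d : ℕ} (hr : rk M univ = d + 1)
    {𝓕 : Set (Set (J n))} (h : IsFlag M 𝓕) (hd : 𝓕.ncard = d) :
    ∃ l, AdmList M l ∧ l.length = d ∧ flagOf M l = 𝓕 := by
  have hE := hM.ground_eq
  have key : ∀ i ≤ d, ∃ l, AdmList M l ∧ l.length = i ∧ flagOf M l = {F ∈ 𝓕 | rk M F ≤ i} ∧
      (cl M l = ∅ ∨ cl M l ∈ 𝓕) := by
    intro i
    induction i with
    | zero =>
      intro _
      have h0 : cl M [] = ∅ := by simp [cl, hM.closure_empty]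
      refine ⟨[], ⟨by simp [IndepList], by simp [h0, IsAdmissible]⟩, rfl, ?_, Or.inl h0⟩
      refine (Set.eq_empty_of_forall_notMem fun F hF => ?_).symm
      have := h.one_le_rk hM hF.1
      have := hF.2
      omega
    | succ i ih =>
      intro hi
      obtain ⟨l, hl, hlen, hfl, hcl⟩ := ih (by omega)
      obtain ⟨F, hF, hFr⟩ := h.exists_rk_eq hM hr hd (i := i + 1) (by omega) hi
      have hsub : cl M l ⊆ F := by
        rcases hcl with h0 | h0
        · rw [h0]; exact empty_subset _
        · refine h.subset_of_rk_le hE h0 hF ?_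
          rw [hl.1.rk_cl]; omega
      have hne : ∃ a ∈ F, a ∉ cl M l := by
        by_contra! hcon
        have := rk_mono (M := M) (show F ⊆ cl M l from hcon)
        rw [hl.1.rk_cl] at this
        omega
      obtain ⟨a, ha, hal⟩ := hne
      have hclF : cl M (a :: l) = F := by
        rw [cl, setOf_mem_cons]
        refine closure_insert_eq_of_rk hE (h.isFlat hF)
          (fun x hx => hsub (mem_cl hE hx)) ha hal ?_
        rw [hl.1, hFr, hlen]
      refine ⟨a :: l, ⟨(indepList_cons hE).2 ⟨hal, hl.1⟩, ?_⟩, by simp [hlen], ?_, Or.inr ?_⟩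
      · rw [hclF]; exact h.admChain.admissible F hF
      · rw [flagOf, hclF, hfl]
        ext G
        simp only [mem_insert_iff, mem_ofPred_eq]
        constructor
        · rintro (rfl | hG)
          · exact ⟨hF, hFr.le⟩
          · exact ⟨hG.1, by omega⟩
        · rintro ⟨hG, hGr⟩
          rcases hGr.eq_or_lt with h1 | h1
          · exact Or.inl (h.eq_of_rk_eq hE hG hF (h1.trans hFr.symm))
          · exact Or.inr ⟨hG, by omega⟩
      · rwa [hclF]
  obtain ⟨l, hl, hlen, hfl, -⟩ := key d le_rfl
  refine ⟨l, hl, hlen, hfl.trans ?_⟩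
  ext F
  exact ⟨fun hF => hF.1, fun hF => ⟨hF, h.rk_le hM hr hF⟩⟩

lemma eq_cl_of_isGreatest {l : List (J n)} {F : Set (J n)} (h : IsGreatest (flagOf M l) F) :
    F = cl M l := by
  cases l with
  | nil => exact h.1.elim
  | cons a l =>
    exact (subset_cl_of_mem_flagOf h.1).antisymm (h.2 (mem_insert _ _))

/-- If a set `A` has full rank, is stable under the involution and is contained in `F ∪ F*` for
an admissible flat `F`, then it contains a basis of an admissible hyperplane. -/
lemma exists_admList (hM : IsAdmissibleMatroid M) {d : ℕ} {A F : Set (J n)} (hF : M.IsFlat F)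
    (hadm : IsAdmissible F) (hA : rk M A = d + 1) (hAs : ∀ a ∈ A, star a ∈ A)
    (hAF : A ⊆ F ∪ starSet F) {i : ℕ} (hi : i + 1 ≤ d) :
    ∃ l, AdmList M l ∧ l.length = i + 1 ∧ ∀ x ∈ l, x ∈ A := by
  have hE := hM.ground_eq
  induction i with
  | zero =>
    have hne : A.Nonempty := by
      rw [nonempty_iff_ne_empty]
      rintro rfl
      rw [rk_empty] at hA
      omega
    -- `IsAdmissibleMatroid.exists_extension` needs a nonempty list; an element of A ∩ F starts one,
    -- its closure being inside F.
    have hex : ∃ a ∈ A, a ∈ F := by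
      obtain ⟨a, ha⟩ := hne
      rcases hAF ha with h | h
      · exact ⟨a, ha, h⟩
      · exact ⟨star a, hAs a ha, mem_starSet.1 h⟩
    obtain ⟨a, ha, haF⟩ := hex
    refine ⟨[a], ⟨(indepList_cons hE).2 ⟨?_, by simp [IndepList]⟩, ?_⟩, rfl, by simpa using ha⟩
    · simp [cl, hM.closure_empty]
    · exact hadm.subset (closure_subset_of_isFlat hF (by simpa using haF))
  | succ i ih =>
    obtain ⟨l, hl, hlen, hlA⟩ := ih (by omega)
    obtain ⟨a, ha, h1, h2⟩ := hM.exists_extension (C := A) hl.1 hl.2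
      (by rintro rfl; simp at hlen) (by omega)
    exact ⟨a :: l, ⟨h1, h2⟩, by simp [hlen], by simpa [ha] using hlA⟩

section Weights

variable {d : ℕ}

lemma flagWeight_eq {c : conesOfDim (bergmanFan M) d → ℤ} {σ : conesOfDim (bergmanFan M) d}
    {𝓕 : Set (Set (J n))} (h : flagCone 𝓕 = σ.1) : flagWeight c 𝓕 = c σ := by
  obtain ⟨σ, hσ⟩ := σ
  obtain rfl : flagCone 𝓕 = σ := h
  exact dif_pos hσ

/-- A list of length d in the intersection is compared with the top flat of each cone by
`Balanced.flagOf_eq_of_subset`. -/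
lemma eq_of_linked (hM : IsAdmissibleMatroid M) (hr : rk M univ = d + 1)
    {c : conesOfDim (bergmanFan M) d → ℤ} (hc : Balanced M d (flagWeight c))
    {σ σ' : conesOfDim (bergmanFan M) d} (h : Linked M d σ σ') : c σ = c σ' := by
  obtain ⟨F, F', ⟨𝓕, h𝓕, h𝓕σ, hF⟩, ⟨𝓕', h𝓕', h𝓕σ', hF'⟩, hrk⟩ := h
  have hd : 𝓕.ncard = d := by rw [← h𝓕.admChain.coneDim_flagCone, h𝓕σ, σ.2.2]
  have hd' : 𝓕'.ncard = d := by rw [← h𝓕'.admChain.coneDim_flagCone, h𝓕σ', σ'.2.2]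
  have hd0 : 0 < d := by
    rw [← hd, ncard_pos (Set.toFinite _)]
    exact ⟨F, hF.1⟩
  obtain ⟨m, hm, hmd, rfl⟩ := h𝓕.exists_list hM hr hd
  obtain ⟨m', hm', hmd', rfl⟩ := h𝓕'.exists_list hM hr hd'
  have hFm := eq_cl_of_isGreatest hF
  have hFm' := eq_cl_of_isGreatest hF'
  subst hFm hFm'
  have hA : rk M ((cl M m ∪ starSet (cl M m)) ∩ (cl M m' ∪ starSet (cl M m'))) = d + 1 := by
    rw [← coe_rk] at hrk
    exact_mod_cast hrk
  obtain ⟨i, rfl⟩ : ∃ i, d = i + 1 := ⟨d - 1, by omega⟩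
  obtain ⟨l, hl, hlen, hlA⟩ := exists_admList hM (M.isFlat_closure _) hm.2 hA
    (fun a ha => by
      refine ⟨?_, ?_⟩
      · rcases ha.1 with h | h
        · exact Or.inr (by simpa using h)
        · exact Or.inl (by simpa using h)
      · rcases ha.2 with h | h
        · exact Or.inr (by simpa using h)
        · exact Or.inl (by simpa using h)) inter_subset_left le_rfl
  have e1 := hc.flagOf_eq_of_subset hM hr (p := []) (q := l) hm hmd hl hlen (by simp)
    fun x hx => (hlA x hx).1
  have e2 := hc.flagOf_eq_of_subset hM hr (p := []) (q := l) hm' hmd' hl hlen (by simp)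
    fun x hx => (hlA x hx).2
  rw [← flagWeight_eq (c := c) h𝓕σ, ← flagWeight_eq (c := c) h𝓕σ', ← e1, ← e2]

/-- The flags compared in `balanced_of_local` are linked. With a common top flat K, the set K ∪ K*
contains K and a star outside it. If the tops differ, the intersection contains F, a and a*, where F
has rank d - 1. -/
lemma balanced_of_linked (hM : IsAdmissibleMatroid M) (hr : rk M univ = d + 1)
    {c : conesOfDim (bergmanFan M) d → ℤ} (hc : ∀ σ σ', Linked M d σ σ' → c σ = c σ') :
    Balanced M d (flagWeight c) := by
  have hE := hM.ground_eq
  have hstep : ∀ {𝓕 𝓕' : Set (Set (J n))} {F F' : Set (J n)}, IsFlag M 𝓕 → 𝓕.ncard = d →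
      IsFlag M 𝓕' → 𝓕'.ncard = d → IsGreatest 𝓕 F → IsGreatest 𝓕' F' →
      d + 1 ≤ rk M ((F ∪ starSet F) ∩ (F' ∪ starSet F')) →
      flagWeight c 𝓕 = flagWeight c 𝓕' := by
    intro 𝓕 𝓕' F F' h hd h' hd' hF hF' hle
    have hrk : rk M ((F ∪ starSet F) ∩ (F' ∪ starSet F')) = d + 1 :=
      ((rk_mono (subset_univ _)).trans hr.le).antisymm hle
    rw [flagWeight_eq (σ := ⟨_, h.flagCone_mem hd⟩) rfl,
      flagWeight_eq (σ := ⟨_, h'.flagCone_mem hd'⟩) rfl]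
    refine hc _ _ ⟨F, F', ⟨𝓕, h, rfl, hF⟩, ⟨𝓕', h', rfl, hF'⟩, ?_⟩
    rw [← coe_rk, hrk]
    norm_cast
  have htop : ∀ {𝓕 : Set (Set (J n))} {F : Set (J n)}, IsFlag M 𝓕 → 𝓕.ncard = d →
      IsGreatest 𝓕 F → rk M F = d := by
    intro 𝓕 F h hd hF
    refine (h.rk_le hM hr hF.1).antisymm ?_
    have hd0 : 0 < d := by
      rw [← hd, ncard_pos (Set.toFinite _)]
      exact ⟨F, hF.1⟩
    obtain ⟨K, hK, hKr⟩ := h.exists_rk_eq hM hr hd hd0 le_rfl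
    rw [← hKr]
    exact rk_mono (hF.2 hK)
  refine balanced_of_local hM hr ?_ ?_
  · intro 𝓣 hd G hG G' hG' H hH hGH hGH'
    have h := (mem_extFlats.1 hG).2
    have h' := (mem_extFlats.1 hG').2
    have h𝓣 : IsFlag M 𝓣 := h.mono (subset_insert _ _)
    obtain ⟨K, hK⟩ := exists_greatest_of_chain h𝓣.2 ⟨H, hH⟩
    have hins : ∀ L, L ⊆ H → IsGreatest (insert L 𝓣) K := by
      refine fun L hL => ⟨Or.inr hK.1, ?_⟩
      rintro T (rfl | hT)
      · exact hL.trans (hK.2 hH)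
      · exact hK.2 hT
    refine hstep h (ncard_insert_extFlats hd hG) h' (ncard_insert_extFlats hd hG')
      (hins G hGH) (hins G' hGH') ?_
    obtain ⟨a, ha⟩ := h𝓣.admChain.nonempty K hK.1
    have hsa : star a ∉ M.closure K := by
      rw [(h𝓣.isFlat hK.1).closure]
      exact (h𝓣.admChain.admissible K hK.1).star_notMem ha
    rw [inter_self, ← htop h (ncard_insert_extFlats hd hG) (hins G hGH),
      ← rk_insert_of_notMem hE hsa]
    exact rk_mono (insert_subset (Or.inr (by simpa using ha)) subset_union_left)
  · intro 𝓣 hd G hG G' hG' hT hT' a ha ha'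
    have h := (mem_extFlats.1 hG).2
    have h' := (mem_extFlats.1 hG').2
    have hins : ∀ L, (∀ T ∈ 𝓣, T ⊆ L) → IsGreatest (insert L 𝓣) L := by
      refine fun L hL => ⟨mem_insert _ _, ?_⟩
      rintro T (rfl | hT)
      · exact subset_rfl
      · exact hL T hT
    refine hstep h (ncard_insert_extFlats hd hG) h' (ncard_insert_extFlats hd hG')
      (hins G hT) (hins G' hT') ?_
    obtain ⟨F, hF, -, hFr, -, hFG⟩ := exists_pred_extFlats hM hr hd hG
    have haF : a ∉ M.closure F := by
      rw [hF.closure]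
      exact fun h => (extFlats_admissible hG').notMem_of_star ha' (hFG G' hG' h)
    have hsa : star a ∉ M.closure (insert a F) := by
      rw [closure_insert_eq_of_rk hE (extFlats_isFlat hG) (hFG G hG) ha haF hFr.ge]
      exact (extFlats_admissible hG).star_notMem ha
    rw [← htop h (ncard_insert_extFlats hd hG) (hins G hT), ← hFr,
      ← rk_insert_of_notMem hE haF, ← rk_insert_of_notMem hE hsa]
    refine rk_mono (insert_subset ⟨?_, Or.inl ha'⟩ (insert_subset ⟨Or.inl ha, ?_⟩ ?_))
    · exact Or.inr (by simpa using ha)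
    · exact Or.inr (by simpa using ha')
    · exact fun x hx => ⟨Or.inl (hFG G hG hx), Or.inl (hFG G' hG' hx)⟩

lemma Linked.symm {σ σ' : conesOfDim (bergmanFan M) d} (h : Linked M d σ σ') :
    Linked M d σ' σ := by
  obtain ⟨F, F', h1, h2, h3⟩ := h
  exact ⟨F', F, h2, h1, by rwa [inter_comm]⟩

theorem isMinkowskiWeight_iff_reflTransGen (hM : IsAdmissibleMatroid M)
    (hr : rk M univ = d + 1) (c : conesOfDim (bergmanFan M) d → ℤ) :
    IsMinkowskiWeight (bergmanFan M) d c ↔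
      ∀ σ σ', Relation.ReflTransGen (Linked M d) σ σ' → c σ = c σ' := by
  rw [isMinkowskiWeight_iff]
  constructor
  · intro h σ σ' hσ
    induction hσ with
    | refl => rfl
    | tail _ hl ih => exact ih.trans (eq_of_linked hM hr h hl)
  · exact fun h => balanced_of_linked hM hr fun σ σ' hl => h σ σ' (Relation.ReflTransGen.single hl)

lemma IsEnvelopingMatroid.rk_univ {S : Set (Set (J n))} (hM : IsEnvelopingMatroid M S)
    (hrank : ∀ B ∈ S, B.encard = (d : ℕ∞) + 1) : rk M univ = d + 1 := by
  obtain ⟨B, hB⟩ := hM.nonempty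
  have h1 := hrank B hB
  rw [hM.eq_bases] at hB
  rw [hB.1.encard_eq_eRank, ← Matroid.eRk_univ_eq, ← coe_rk] at h1
  exact_mod_cast h1

end Weights

end RankedSymplectic

theorem theorem5p12 {n : ℕ} (d : ℕ) (S : Set (Set (RankedSymplectic.J n)))
    (M : Matroid (RankedSymplectic.J n))
    (hM : RankedSymplectic.IsEnvelopingMatroid M S)
    (hrank : ∀ B ∈ S, B.encard = (d : ℕ∞) + 1) :
    (∀ σ σ' : RankedSymplectic.conesOfDim (RankedSymplectic.bergmanFan M) d,
      (∀ c : RankedSymplectic.conesOfDim (RankedSymplectic.bergmanFan M) d → ℤ,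
        RankedSymplectic.IsMinkowskiWeight (RankedSymplectic.bergmanFan M) d c → c σ = c σ') ↔
      Relation.ReflTransGen (RankedSymplectic.Linked M d) σ σ') ∧
    (∀ c : RankedSymplectic.conesOfDim (RankedSymplectic.bergmanFan M) d → ℤ,
      RankedSymplectic.IsMinkowskiWeight (RankedSymplectic.bergmanFan M) d c ↔
      ∀ σ σ' : RankedSymplectic.conesOfDim (RankedSymplectic.bergmanFan M) d,
        Relation.ReflTransGen (RankedSymplectic.Linked M d) σ σ' → c σ = c σ') := by
  classical
  have hr := hM.rk_univ hrank
  have key := RankedSymplectic.isMinkowskiWeight_iff_reflTransGen hM.admissible hr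
  refine ⟨fun σ σ' => ⟨fun h => ?_, fun h c hc => (key c).1 hc σ σ' h⟩, key⟩
  -- The indicator of the class of σ is constant on classes because linkage is symmetric. Its values
  -- at σ and σ' agree only if σ' is in the class.
  have hw := (key fun τ => if Relation.ReflTransGen (RankedSymplectic.Linked M d) σ τ then 1
    else 0).2 fun τ τ' hτ => by
      have : Std.Symm (RankedSymplectic.Linked M d) := ⟨fun _ _ h => h.symm⟩
      have hsymm : Relation.ReflTransGen (RankedSymplectic.Linked M d) τ' τ :=
        Std.Symm.symm _ _ hτ
      have : Relation.ReflTransGen (RankedSymplectic.Linked M d) σ τ ↔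
          Relation.ReflTransGen (RankedSymplectic.Linked M d) σ τ' :=
        ⟨fun h => h.trans hτ, fun h => h.trans hsymm⟩
      simp only [this]
  have := h _ hw
  simpa [Relation.ReflTransGen.refl] using this.symm
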